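/- Let $X$ be a complete separable metric space. A Borel measure on $X$ is called locally finite if it is finite on all bounded Borel sets. Let $\mathcal M^{\cdot\cdot}$ be the space of locally finite point measures on $X$ (measures with values in $\{0,1,2,\dots\}$ on bounded Borel sets), with the $\sigma$-field generated by the evaluations $\zeta_B(\mu)=\mu(B)$, $B$ bounded Borel. For bounded Borel $B$ let $\xi_B(\mu)=\#\{x\in B:\mu(\{x\})>0\}$ be the number of occupied sites in $B$. Fix $z\in(0,1)$ and a locally finite measure $\rho$ on $X$ that is diffuse ($\rho(\{x\})=0$ for all $x$) and infinite ($\rho(X)=\infty$), and bounded Borel sets $B_1\subseteq B_2\subseteq\cdots$ with $\bigcup_k B_k=X$ such that every bounded Borel set is contained in some $B_k$. For a locally finite measure $\sigma$, the Pólya sum process $\mathrm{Poy}_{z,\sigma}$ is the unique probability measure $Q$ on $\mathcal M^{\cdot\cdot}$ such that, for all measurable $h\ge 0$ on $X\times\mathcal M^{\cdot\cdot}$, $$\iint h(x,\mu)\,\mu(dx)\,Q(d\mu)=z\iint h(x,\mu+\delta_x)\,(\sigma+\mu)(dx)\,Q(d\mu).$$ For bounded Borel $B$ let $\mathcal G_B$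 be the $\sigma$-field generated by $\xi_B$ and by the increments $\zeta_{B'}-\zeta_B$, $B'\supseteq B$ bounded Borel, and let $\mathcal G_\infty=\bigcap_k\mathcal G_{B_k}$ be the tail $\sigma$-field. Let $\pi_B$ be the version of $\mathrm{Poy}_{z,\rho}(\,\cdot\mid\mathcal G_B)$ given by $$\pi_B(\mu,A)=\mathrm{Poy}_{z,\rho}\bigl(\{\nu:\nu|_B+\mu|_{B^c}\in A\}\bigm|\{\nu:\xi_B(\nu)=\xi_B(\mu)\}\bigr)$$ (with $\pi_B(\mu,\cdot)=0$ if the conditioning event has probability $0$), and let $C(\pi^{\mathcal G})$ be the set of all probability measures $P$ on $\mathcal M^{\cdot\cdot}$ such that $P(A\mid\mathcal G_B)=\pi_B(\,\cdot\,,A)$ $P$-a.s. for all bounded Borel $B$ and all measurable $A\subseteq\mathcal M^{\cdot\cdot}$. Let $$W(\mu)=\lim_{k\to\infty}\frac{\xi_{B_k}(\mu)}{-\log(1-z)\,\rho(B_k)}$$ whenever this limit exists in $\mathbb R$, and $W(\mu)=0$ otherwise. Then the measures $\mathrm{Poy}_{z,w\rho}$, $0\le w<\infty$, are well defined (there is exactly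 one solution of the integral equation with $\sigma=w\rho$), and for every $P\in C(\pi^{\mathcal G})$: 1. for $P$-a.e. $\mu$ the limit defining $W(\mu)$ exists; 2. for every $\varphi\in L^1(P)$ one has, for $P$-a.e. $\mu$, $\varphi\in L^1(\mathrm{Poy}_{z,W(\mu)\rho})$ and $$P(\varphi\mid\mathcal G_\infty)(\mu)=\int\varphi\,d\mathrm{Poy}_{z,W(\mu)\rho};$$ 3. $\displaystyle\frac{\xi_{B_k}(\mu)}{\rho(B_k)}\longrightarrow -W(\mu)\log(1-z)$ as $k\to\infty$, for $P$-a.e. $\mu$. -/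

import Mathlib

open MeasureTheory ProbabilityTheory Filter Topology
open scoped ENNReal NNReal

namespace PolyaSum

/-- The ring of bounded Borel sets of a metric space. -/
abbrev BddBorel (X : Type*) [MetricSpace X] [MeasurableSpace X] : Type _ :=
  {B : Set X // MeasurableSet B ∧ Bornology.IsBounded B}

section Basic

variable {X : Type*} [MetricSpace X] [MeasurableSpace X]

/-- Locally finite measures: finite on every bounded Borel set. -/
def LocallyFinite (ρ : Measure X) : Prop :=
  ∀ B : BddBorel X, ρ B < ∞

variable (X) in
/-- Locally finite point measures: measures with a value in `{0, 1, 2, …}` on every bounded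
Borel set. -/
@[ext]
structure PointMeasure where
  toMeasure : Measure X
  exists_nat : ∀ B : BddBorel X, ∃ n : ℕ, toMeasure B = n

namespace PointMeasure

/-- The evaluation `ζ_B(μ) = μ(B)`. -/
def eval (B : BddBorel X) (μ : PointMeasure X) : ℝ≥0∞ := μ.1 B

/-- The σ-field generated by all evaluations on bounded Borel sets. -/
instance : MeasurableSpace (PointMeasure X) :=
  ⨆ B : BddBorel X, MeasurableSpace.comap (eval B) inferInstance

/-- `μ + δ_x`. -/
noncomputable def addDirac (μ : PointMeasure X) (x : X) : PointMeasure X :=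
  ⟨μ.1 + Measure.dirac x, fun B => by
    classical
    obtain ⟨n, hn⟩ := μ.2 B
    by_cases hx : x ∈ (B : Set X)
    · exact ⟨n + 1, by simp [hn, Measure.dirac_apply' x B.2.1, hx]⟩
    · exact ⟨n, by simp [hn, Measure.dirac_apply' x B.2.1, hx]⟩⟩

/-- `ν_B + μ_{Bᶜ}`: the configuration `ν` inside `B` and `μ` outside `B`. -/
noncomputable def splice (B : BddBorel X) (ν μ : PointMeasure X) : PointMeasure X :=
  ⟨ν.1.restrict B + μ.1.restrict (B : Set X)ᶜ, fun A => by
    obtain ⟨n, hn⟩ := ν.2 ⟨A ∩ B, A.2.1.inter B.2.1, A.2.2.subset Set.inter_subset_left⟩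
    obtain ⟨m, hm⟩ := μ.2
      ⟨A ∩ (B : Set X)ᶜ, A.2.1.inter B.2.1.compl, A.2.2.subset Set.inter_subset_left⟩
    refine ⟨n + m, ?_⟩
    simp only at hn hm
    rw [Measure.add_apply, Measure.restrict_apply A.2.1, Measure.restrict_apply A.2.1, hn, hm]
    push_cast
    rfl⟩

/-- `ξ_B(μ)`: the number of occupied sites of `μ` in `B`, multiplicities not counted. For a
bounded `B` the set is finite, as each of its points has mass at least one. -/
noncomputable def sites (B : BddBorel X) (μ : PointMeasure X) : ℕ :=
  {x ∈ (B : Set X) | μ.1 {x} ≠ 0}.ncard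

end PointMeasure

open PointMeasure

/-- `Q` is a probability measure on the space of point measures that solves the integral equation
`∬ h(x, μ) μ(dx) Q(dμ) = z ∬ h(x, μ + δ_x) (ρ + μ)(dx) Q(dμ)` for all measurable `h ≥ 0`. -/
def IsPolyaSumProcess (z : ℝ) (ρ : Measure X) (Q : Measure (PointMeasure X)) : Prop :=
  IsProbabilityMeasure Q ∧
    ∀ h : X × PointMeasure X → ℝ≥0∞, Measurable h →
      ∫⁻ μ, ∫⁻ x, h (x, μ) ∂μ.1 ∂Q =
        ENNReal.ofReal z * ∫⁻ μ, ∫⁻ x, h (x, μ.addDirac x) ∂(ρ + μ.1) ∂Q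

open Classical in
/-- The Pólya sum process `Poy_{z,ρ}`: the solution of the integral equation (which exists and
is unique for `0 < z < 1` and locally finite `ρ`). -/
noncomputable def polya (z : ℝ) (ρ : Measure X) : Measure (PointMeasure X) :=
  if h : ∃ Q, IsPolyaSumProcess z ρ Q then h.choose else 0

/-- The σ-field of outside events, generated by the increments `ζ_{B'} - ζ_B`, `B ⊆ B'`. -/
@[reducible] noncomputable def outside (B : BddBorel X) : MeasurableSpace (PointMeasure X) :=
  ⨆ (B' : BddBorel X) (_ : (B : Set X) ⊆ B'),
    MeasurableSpace.comap (fun μ => eval B' μ - eval B μ) inferInstance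

/-- The σ-field `𝒢_B` generated by the outside events and by the number of occupied sites
in `B`. -/
@[reducible] noncomputable def siteField (B : BddBorel X) : MeasurableSpace (PointMeasure X) :=
  outside B ⊔ MeasurableSpace.comap (sites B) ⊤

/-- The tail σ-field `⋂ₙ 𝒢_{Bₙ}`. -/
@[reducible] noncomputable def tailField (B : ℕ → BddBorel X) : MeasurableSpace (PointMeasure X) :=
  ⨅ n, siteField (B n)

/-- The kernel `π_B(μ, ·) = Poy_{z,ρ}(ν_B + μ_{Bᶜ} ∈ · | ξ_B(ν) = ξ_B(μ))`, the version of
`Poy_{z,ρ}(· | 𝒢_B)(μ)` given by elementary conditioning. If the condition has probability zero,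
which for `0 < z < 1` happens only if `ρ(B) = 0` and `ξ_B(μ) > 0`, this is the zero measure. -/
noncomputable def siteKernel (z : ℝ) (ρ : Measure X) (B : BddBorel X) (μ : PointMeasure X) :
    Measure (PointMeasure X) :=
  ((polya z ρ)[|{ν | sites B ν = sites B μ}]).map (fun ν => splice B ν μ)

/-- `C(π)`: the point processes `P` with `P(A | 𝒢_B) = π_B(·, A)` `P`-almost surely, for all
bounded Borel sets `B` and all events `A`. -/
def siteEnsemble (z : ℝ) (ρ : Measure X) : Set (Measure (PointMeasure X)) :=
  {P | IsProbabilityMeasure P ∧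
    ∀ (B : BddBorel X) (A : Set (PointMeasure X)), MeasurableSet A →
      P[A.indicator (fun _ => (1 : ℝ)) | siteField B] =ᵐ[P]
        fun μ => (siteKernel z ρ B μ).real A}

/-- `W_k(μ) = ξ_{B_k}(μ) / (-log(1 - z) ρ(B_k))`. -/
noncomputable def siteRatio (z : ℝ) (ρ : Measure X) (B : ℕ → BddBorel X) (k : ℕ)
    (μ : PointMeasure X) : ℝ :=
  (sites (B k) μ : ℝ) / (-Real.log (1 - z) * ρ.real (B k))

/-- The set of configurations for which `lim_k W_k(μ)` exists (in `ℝ`). -/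
def convergenceSet (z : ℝ) (ρ : Measure X) (B : ℕ → BddBorel X) : Set (PointMeasure X) :=
  {μ | ∃ w : ℝ, Tendsto (fun k => siteRatio z ρ B k μ) atTop (𝓝 w)}

open Classical in
/-- `W(μ) = lim_k W_k(μ)` if the limit exists, and `0` otherwise. -/
noncomputable def siteLimit (z : ℝ) (ρ : Measure X) (B : ℕ → BddBorel X)
    (μ : PointMeasure X) : ℝ :=
  if h : ∃ w : ℝ, Tendsto (fun k => siteRatio z ρ B k μ) atTop (𝓝 w) then h.choose else 0

end Basic

end PolyaSum

/-! ### Measurability on the space of point measures, and the atoms of a configuration -/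

namespace PolyaSum

open PointMeasure

section Measurability

variable {X : Type*} [MetricSpace X] [MeasurableSpace X]

/-! For diffuse `σ` the Pólya sum process is compound Poisson: the occupied sites form a Poisson
process of intensity `-log (1 - z) σ`, and the sites carry independent multiplicities with weights
proportional to `z ^ m / m`. This comes out of the integral equation by iterating it over the
multiplicity of the distinguished point (`IsPolyaSumProcess.lintegral_mult`). Everything is tested
on the events `void C`, which form a generating π-system (`generateFrom_voidSystem`) and have
probability `exp (-λ(C))`, where `λ` is the Lévy measure `levy`. This gives uniqueness; existence is
an explicit construction (`exists_solvesMecke`).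

Given their number in `B`, the marked sites in `B` are i.i.d., so `π_B` gives a void event inside
`B` the probability `(1 - λ(C) / λ(B)) ^ ξ_B` (`siteKernel_void`). Under `P ∈ C(π)` these are
conditional probabilities along the decreasing fields `𝒢_{B_k}`, hence they converge almost surely.
As `λ(B_k) → ∞`, this forces `ξ_{B_k} / λ(B_k)` to converge or to tend to infinity
(`tendsto_div_of_tendsto_one_sub_div_pow`). Divergence is a null event: on it "no multiplicity above
`r` in `B_j`" would have probability zero for every `r`, yet each configuration satisfies this for
some `r`.

So `W` exists almost surely, and the conditional void probabilities tend to `exp (-W λ(C))`, the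
void probabilities of `Poy_{z,Wρ}`. Integrating over tail events and using the π-system identifies
the tail conditional law (`comp_restrict_tail`). -/

theorem exists_disjoint_bounded_cover (X : Type*) [MetricSpace X] [MeasurableSpace X]
    [BorelSpace X] :
    ∃ D : ℕ → BddBorel X, Pairwise (Function.onFun Disjoint fun i => (D i : Set X)) ∧
      ⋃ i, (D i : Set X) = Set.univ ∧
      ∀ A : Set X, Bornology.IsBounded A → ∃ N, ∀ i, N ≤ i → Disjoint (D i : Set X) A := by
  rcases isEmpty_or_nonempty X with h | ⟨⟨x⟩⟩
  · exact ⟨fun _ => ⟨∅, MeasurableSet.empty, Bornology.isBounded_empty⟩,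
      fun i j _ => Set.disjoint_empty _, Subsingleton.elim _ _,
      fun A _ => ⟨0, fun i _ => Set.empty_disjoint _⟩⟩
  · have hm : Monotone fun n : ℕ => Metric.closedBall x (n : ℝ) :=
      fun a b h => Metric.closedBall_subset_closedBall (by exact_mod_cast h)
    refine ⟨fun n => ⟨disjointed (fun n : ℕ => Metric.closedBall x (n : ℝ)) n,
      MeasurableSet.disjointed (fun _ => Metric.isClosed_closedBall.measurableSet) n,
      Metric.isBounded_closedBall.subset (disjointed_subset _ n)⟩,
      disjoint_disjointed _, ?_, fun A hA => ?_⟩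
    · rw [iUnion_disjointed]
      exact Metric.iUnion_closedBall_nat x
    · obtain ⟨r, hr⟩ := hA.subset_closedBall x
      obtain ⟨N, hN⟩ := exists_nat_ge r
      refine ⟨N + 1, fun i hi => ?_⟩
      have hdisj : Disjoint (disjointed (fun n : ℕ => Metric.closedBall x (n : ℝ)) i)
          (Metric.closedBall x (N : ℝ)) := by
        obtain ⟨j, rfl⟩ : ∃ j, i = j + 1 := ⟨i - 1, by omega⟩
        rw [hm.disjointed_add_one]
        exact Set.disjoint_sdiff_left.mono_right (hm (by omega))
      exact hdisj.mono_right (hr.trans (Metric.closedBall_subset_closedBall hN))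

theorem LocallyFinite.sigmaFinite [BorelSpace X] {σ : Measure X} (hσ : LocallyFinite σ) :
    SigmaFinite σ := by
  obtain ⟨D, -, hD, -⟩ := exists_disjoint_bounded_cover X
  exact ⟨⟨⟨fun i => D i, fun _ => trivial, fun i => hσ (D i), hD⟩⟩⟩

namespace PointMeasure

theorem locallyFinite (μ : PointMeasure X) : LocallyFinite μ.1 := fun B => by
  obtain ⟨n, hn⟩ := μ.2 B
  simp [hn]

instance [BorelSpace X] (μ : PointMeasure X) : SigmaFinite μ.1 := μ.locallyFinite.sigmaFinite

theorem measure_eq_zero_of_lt_one (μ : PointMeasure X) {A : BddBorel X} (h : μ.1 A < 1) :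
    μ.1 A = 0 := by
  obtain ⟨n, hn⟩ := μ.2 A
  rw [hn] at h ⊢
  have : n < 1 := by exact_mod_cast h
  simp; omega

/-- The configurations that have no site of multiplicity `m + 1` in `C m`, for any `m`. -/
def void (C : ℕ → Set X) : Set (PointMeasure X) := {μ | ∀ m, ∀ x ∈ C m, μ.1 {x} ≠ (m + 1 : ℕ)}

theorem void_inter (C D : ℕ → Set X) : void C ∩ void D = void fun m => C m ∪ D m := by
  ext μ
  simp only [void, Set.mem_inter_iff, Set.mem_ofPred_eq, Set.mem_union, or_imp, forall_and]

theorem measure_mult_eq_zero_iff (μ : PointMeasure X) (n : ℕ) (A : Set X) :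
    μ.1 {x ∈ A | μ.1 {x} = (n + 1 : ℕ)} = 0 ↔ ∀ x ∈ A, μ.1 {x} ≠ (n + 1 : ℕ) := by
  refine ⟨fun h x hx hm => ?_, fun h => ?_⟩
  · have := measure_mono_null (Set.singleton_subset_iff.2
      (show x ∈ {x ∈ A | μ.1 {x} = (n + 1 : ℕ)} from ⟨hx, hm⟩)) h
    rw [hm] at this
    exact absurd this (by simp)
  · convert measure_empty (μ := μ.1)
    ext x
    simpa using fun hx => by simpa using h x hx

theorem measurable_eval (B : BddBorel X) : Measurable (eval B) :=
  measurable_iff_comap_le.2 (le_iSup (fun B : BddBorel X =>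
    MeasurableSpace.comap (eval B) inferInstance) B)

theorem measurable_iff {α : Type*} [MeasurableSpace α] {f : α → PointMeasure X} :
    Measurable f ↔ ∀ B : BddBorel X, Measurable fun a => (f a).1 B := by
  refine ⟨fun h B => (measurable_eval B).comp h, fun h => ?_⟩
  rw [measurable_iff_comap_le]
  simp only [instMeasurableSpace, MeasurableSpace.comap_iSup, MeasurableSpace.comap_comp,
    iSup_le_iff]
  exact fun B => measurable_iff_comap_le.1 (h B)

theorem measurable_toMeasure [BorelSpace X] :
    Measurable (toMeasure : PointMeasure X → Measure X) := by
  obtain ⟨D, hd, hD, -⟩ := exists_disjoint_bounded_cover X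
  refine Measure.measurable_of_measurable_coe _ fun A hA => ?_
  have h : ∀ μ : PointMeasure X, μ.1 A = ∑' i, μ.1 (A ∩ D i) := fun μ => by
    rw [← measure_iUnion (fun i j hij => (hd hij).mono Set.inter_subset_right
      Set.inter_subset_right) fun i => hA.inter (D i).2.1, ← Set.inter_iUnion, hD, Set.inter_univ]
  simp_rw [h]
  exact Measurable.tsum fun i => measurable_eval
    (⟨A ∩ D i, hA.inter (D i).2.1, (D i).2.2.subset Set.inter_subset_right⟩ : BddBorel X)

variable (X) in
/-- The identity `μ ↦ μ` as a kernel from configurations to sites. -/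
noncomputable def config [BorelSpace X] : Kernel (PointMeasure X) X :=
  ⟨toMeasure, measurable_toMeasure⟩

@[simp]
theorem config_apply [BorelSpace X] (μ : PointMeasure X) : config X μ = μ.1 := rfl

/-- The masses `μ(D i)` have no bound uniform in `μ`, so the kernel is also cut according to the
value `n` of `μ(D i)`; each piece then has mass at most `n`. -/
instance [BorelSpace X] : IsSFiniteKernel (config X) := by
  classical
  obtain ⟨D, hd, hD, -⟩ := exists_disjoint_bounded_cover X
  have hm : ∀ i (n : ℕ), MeasurableSet {μ : PointMeasure X | μ.1 (D i) = n} := fun i n =>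
    measurable_eval (D i) (measurableSet_singleton (n : ℝ≥0∞))
  let κ : ℕ × ℕ → Kernel (PointMeasure X) X := fun p =>
    Kernel.piecewise (hm p.1 p.2) ((config X).restrict (D p.1).2.1) 0
  have hκ : ∀ p, IsFiniteKernel (κ p) := fun p => ⟨⟨p.2, by simp, fun μ => by
    simp only [κ, Kernel.piecewise_apply, Kernel.restrict_apply, config_apply, Set.mem_ofPred_eq]
    split_ifs with h
    · simp [h]
    · simp⟩⟩
  have hsum : config X = Kernel.sum κ := by
    ext μ A hA
    rw [Kernel.sum_apply, Measure.sum_apply _ hA, ENNReal.tsum_prod (f := fun i n => κ (i, n) μ A)]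
    have h1 : ∀ i, ∑' n, κ (i, n) μ A = μ.1 (A ∩ D i) := fun i => by
      obtain ⟨n, hn⟩ := μ.2 (D i)
      rw [tsum_eq_single n]
      · simp [κ, Kernel.piecewise_apply, Kernel.restrict_apply, hn, Measure.restrict_apply hA]
      · intro m hmn
        have : ¬ ((n : ℝ≥0∞) = m) := fun h => hmn (by exact_mod_cast h.symm)
        simp [κ, Kernel.piecewise_apply, hn, this]
    simp_rw [h1, config_apply]
    rw [← measure_iUnion (fun i j hij => (hd hij).mono Set.inter_subset_right
      Set.inter_subset_right) fun i => hA.inter (D i).2.1, ← Set.inter_iUnion, hD, Set.inter_univ]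
  rw [hsum]
  infer_instance

theorem measurable_lintegral [BorelSpace X] {α : Type*} [MeasurableSpace α]
    {g : α → PointMeasure X} (hg : Measurable g) {f : α × X → ℝ≥0∞} (hf : Measurable f) :
    Measurable fun a => ∫⁻ x, f (a, x) ∂(g a).1 :=
  Measurable.lintegral_kernel_prod_right' (κ := (config X).comap g hg) hf

/-- `(x, μ) ↦ μ {x}` is jointly measurable. -/
theorem measurable_mass [BorelSpace X] [SecondCountableTopology X] :
    Measurable fun p : X × PointMeasure X => p.2.1 {p.1} := by
  have h : Measurable fun q : (X × PointMeasure X) × X =>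
      Set.indicator {q : (X × PointMeasure X) × X | q.2 = q.1.1} (fun _ => (1 : ℝ≥0∞)) q :=
    measurable_const.indicator (measurableSet_eq_fun measurable_snd
      (measurable_fst.comp measurable_fst))
  convert measurable_lintegral measurable_snd h using 2 with p
  rw [← lintegral_indicator_one (measurableSet_singleton p.1)]
  rfl

section Atoms

variable [BorelSpace X] [SecondCountableTopology X] (μ : PointMeasure X)

theorem exists_mass_eq (x : X) : ∃ n : ℕ, μ.1 {x} = n :=
  μ.2 ⟨{x}, measurableSet_singleton x, Bornology.isBounded_singleton⟩

/-- Balls shrinking to a point without mass eventually have mass below one, hence zero by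
integrality. The points without mass are thus locally null, and second countability makes them null.
-/
theorem ae_mass_ne_zero : ∀ᵐ x ∂μ.1, μ.1 {x} ≠ 0 := by
  refine measure_null_of_locally_null _ fun x hx => ?_
  have hx : μ.1 {x} = 0 := by simpa using hx
  have hlim : Tendsto (fun n : ℕ => μ.1 (Metric.closedBall x (1 / ((n : ℝ) + 1)))) atTop
      (𝓝 (μ.1 (⋂ n : ℕ, Metric.closedBall x (1 / ((n : ℝ) + 1))))) := by
    refine tendsto_measure_iInter_atTop
      (fun n => Metric.isClosed_closedBall.measurableSet.nullMeasurableSet)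
      (fun a b h => Metric.closedBall_subset_closedBall ?_) ⟨0, ?_⟩
    · exact Nat.one_div_le_one_div h
    · exact (μ.locallyFinite ⟨_, Metric.isClosed_closedBall.measurableSet,
        Metric.isBounded_closedBall⟩).ne
  have hI : ⋂ n : ℕ, Metric.closedBall x (1 / ((n : ℝ) + 1)) = {x} := by
    ext y
    simp only [Set.mem_iInter, Metric.mem_closedBall, Set.mem_singleton_iff]
    refine ⟨fun h => dist_le_zero.1 (ge_of_tendsto' tendsto_one_div_add_atTop_nhds_zero_nat h), ?_⟩
    rintro rfl n
    simp; positivity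
  rw [hI, hx] at hlim
  obtain ⟨n, hn⟩ := ((tendsto_order.1 hlim).2 1 zero_lt_one).exists
  exact ⟨Metric.closedBall x (1 / ((n : ℝ) + 1)),
    mem_nhdsWithin_of_mem_nhds (Metric.closedBall_mem_nhds x Nat.one_div_pos_of_nat),
    μ.measure_eq_zero_of_lt_one (A := ⟨_, Metric.isClosed_closedBall.measurableSet,
      Metric.isBounded_closedBall⟩) hn⟩

theorem finite_sites (B : BddBorel X) : {x ∈ (B : Set X) | μ.1 {x} ≠ 0}.Finite := by
  by_contra hinf
  obtain ⟨n, hn⟩ := μ.2 B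
  obtain ⟨s, hs, hcard⟩ := Set.Infinite.exists_subset_card_eq hinf (n + 1)
  have h1 : μ.1 s ≤ n := hn ▸ measure_mono fun x hx => (hs hx).1
  rw [← sum_measure_singleton] at h1
  have h2 : ∀ x ∈ s, (1 : ℝ≥0∞) ≤ μ.1 {x} := fun x hx => by
    obtain ⟨k, hk⟩ := μ.exists_mass_eq x
    have := (hs hx).2
    rw [hk] at this ⊢
    exact_mod_cast Nat.one_le_iff_ne_zero.2 (by exact_mod_cast this)
  have h3 := (Finset.sum_le_sum h2).trans h1
  simp only [Finset.sum_const, hcard, nsmul_eq_mul, mul_one] at h3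
  have : n + 1 ≤ n := by exact_mod_cast h3
  omega

theorem countable_support : {x | μ.1 {x} ≠ 0}.Countable := by
  obtain ⟨D, -, hD, -⟩ := exists_disjoint_bounded_cover X
  refine (Set.countable_iUnion fun i => (μ.finite_sites (D i)).countable).mono fun x hx => ?_
  obtain ⟨i, hi⟩ := Set.mem_iUnion.1 (hD.symm ▸ Set.mem_univ x : x ∈ ⋃ i, (D i : Set X))
  exact Set.mem_iUnion.2 ⟨i, hi, hx⟩

theorem setLIntegral_eq_sum (B : BddBorel X) (f : X → ℝ≥0∞) :
    ∫⁻ x in B, f x ∂μ.1 = ∑ x ∈ (μ.finite_sites B).toFinset, f x * μ.1 {x} := by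
  rw [← lintegral_finset]
  refine setLIntegral_congr ?_
  filter_upwards [μ.ae_mass_ne_zero] with x hx
  refine propext ⟨fun h => ?_, fun h => ?_⟩
  · exact (Set.Finite.mem_toFinset _).2 ⟨h, hx⟩
  · exact ((Set.Finite.mem_toFinset _).1 h).1

theorem measure_eq_sum (B : BddBorel X) :
    μ.1 B = ∑ x ∈ (μ.finite_sites B).toFinset, μ.1 {x} := by
  simpa using μ.setLIntegral_eq_sum B 1

/-- Weighting an atom by its inverse mass counts it once. Writing `ξ_B` as an integral against `μ`
gives its measurability and brings it within reach of the integral equation. -/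
theorem sites_eq_lintegral (B : BddBorel X) :
    (sites B μ : ℝ≥0∞) = ∫⁻ x in B, (μ.1 {x})⁻¹ ∂μ.1 := by
  rw [setLIntegral_eq_sum, Finset.sum_congr rfl (g := fun _ => 1), Finset.sum_const, sites,
    Set.ncard_eq_toFinset_card _ (μ.finite_sites B)]
  · simp
  · intro x hx
    obtain ⟨n, hn⟩ := μ.exists_mass_eq x
    exact ENNReal.inv_mul_cancel ((Set.Finite.mem_toFinset _).1 hx).2 (by simp [hn])

end Atoms

variable [BorelSpace X] [SecondCountableTopology X]

theorem measurable_sites (B : BddBorel X) : Measurable (sites (X := X) B) := by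
  have h : Measurable fun μ : PointMeasure X => (sites B μ : ℝ≥0∞) := by
    simp_rw [sites_eq_lintegral, ← lintegral_indicator B.2.1]
    refine measurable_lintegral measurable_id
      (f := fun q : PointMeasure X × X => (B : Set X).indicator (fun x => (q.1.1 {x})⁻¹) q.2) ?_
    refine Measurable.indicator (s := Prod.snd ⁻¹' (B : Set X))
      (f := fun q : PointMeasure X × X => (q.1.1 {q.2})⁻¹) ?_ (measurable_snd B.2.1)
    exact (measurable_mass.comp measurable_swap).inv
  refine measurable_to_countable' fun n => ?_
  convert h (measurableSet_singleton (n : ℝ≥0∞)) using 1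
  ext μ
  simp

theorem measurableSet_mult (n : ℕ) {A : Set X} (hA : MeasurableSet A) :
    MeasurableSet {q : PointMeasure X × X | q.2 ∈ A ∧ q.1.1 {q.2} = n} :=
  (measurable_snd hA).inter ((measurable_mass.comp measurable_swap) (measurableSet_singleton _))

theorem measurable_measure_mult (n : ℕ) {A : Set X} (hA : MeasurableSet A) :
    Measurable fun μ : PointMeasure X => μ.1 {x ∈ A | μ.1 {x} = n} := by
  have := measurable_lintegral measurable_id
    (measurable_const.indicator (measurableSet_mult n hA) (f := fun _ => (1 : ℝ≥0∞)))
  convert this using 2 with μ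
  rw [← lintegral_indicator_one]
  · rfl
  · exact measurable_prodMk_left (measurableSet_mult n hA)

/-- The uncountable quantifier over the points of `C m` is replaced by the vanishing of a mass that
depends measurably on `μ`. -/
theorem measurableSet_void {C : ℕ → Set X} (hC : ∀ m, MeasurableSet (C m)) :
    MeasurableSet (void C) := by
  have : void C = ⋂ m, {μ : PointMeasure X | μ.1 {x ∈ C m | μ.1 {x} = (m + 1 : ℕ)} = 0} := by
    ext μ
    simp only [void, Set.mem_iInter, Set.mem_ofPred_eq, measure_mult_eq_zero_iff]
  rw [this]
  exact .iInter fun m => measurable_measure_mult (m + 1) (hC m) (measurableSet_singleton 0)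

end PointMeasure

end Measurability

end PolyaSum

/-! ### Void events as a generating π-system -/

namespace PolyaSum

open PointMeasure

section VoidSystem

variable {X : Type*} [MetricSpace X] [MeasurableSpace X]

variable (X) in
/-- The void events of bounded families of Borel sets. -/
def voidSystem : Set (Set (PointMeasure X)) :=
  {V | ∃ (B : BddBorel X) (C : ℕ → Set X), (∀ m, MeasurableSet (C m)) ∧
    (∀ m, C m ⊆ B) ∧ V = void C}

theorem isPiSystem_voidSystem : IsPiSystem (voidSystem X) := by
  rintro _ ⟨B, C, hC, hCB, rfl⟩ _ ⟨B', C', hC', hCB', rfl⟩ -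
  exact ⟨⟨B ∪ B', B.2.1.union B'.2.1, B.2.2.union B'.2.2⟩, _, fun m => (hC m).union (hC' m),
    fun m => Set.union_subset_union (hCB m) (hCB' m), void_inter C C'⟩

variable [BorelSpace X] [SecondCountableTopology X]

namespace PointMeasure

theorem finite_mult (μ : PointMeasure X) (B : BddBorel X) (m : ℕ) :
    {x ∈ (B : Set X) | μ.1 {x} = (m + 1 : ℕ)}.Finite :=
  (μ.finite_sites B).subset fun x hx => ⟨hx.1, by rw [hx.2]; simp⟩

theorem measure_eq_tsum_mult (μ : PointMeasure X) (B : BddBorel X) :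
    μ.1 B = ∑' m : ℕ, ((m + 1 : ℕ) : ℝ≥0∞) * {x ∈ (B : Set X) | μ.1 {x} = (m + 1 : ℕ)}.ncard := by
  classical
  have h1 : ∀ x ∈ (μ.finite_sites B).toFinset,
      μ.1 {x} = ∑' m : ℕ, if μ.1 {x} = (m + 1 : ℕ) then ((m + 1 : ℕ) : ℝ≥0∞) else 0 := by
    intro x hx
    obtain ⟨k, hk⟩ := μ.exists_mass_eq x
    have hk0 : k ≠ 0 := by
      rintro rfl
      exact ((Set.Finite.mem_toFinset _).1 hx).2 (by simpa using hk)
    obtain ⟨j, rfl⟩ := Nat.exists_eq_succ_of_ne_zero hk0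
    rw [tsum_eq_single j]
    · simp [hk]
    · intro i hi
      rw [if_neg]
      rw [hk]
      intro h
      have : j + 1 = i + 1 := by exact_mod_cast h
      omega
  rw [measure_eq_sum, Finset.sum_congr rfl h1, ← Summable.tsum_finsetSum fun _ _ => ENNReal.summable]
  refine tsum_congr fun m => ?_
  rw [← Finset.sum_filter, Finset.sum_const, nsmul_eq_mul, mul_comm]
  congr 2
  rw [← Set.ncard_coe_finset]
  congr 1
  ext x
  simp only [Finset.coe_filter, Set.Finite.mem_toFinset, Set.mem_ofPred_eq]
  exact ⟨fun h => ⟨h.1.1, h.2⟩, fun h => ⟨⟨h.1, by rw [h.2]; simp⟩, h.2⟩⟩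

/-- A basic open set isolates one point of a finite set from the others. Counting is thereby reduced
to countably many conditions with smaller counts, as needed for an induction inside a σ-field. -/
theorem succ_le_ncard_mult_iff (μ : PointMeasure X) (B : BddBorel X) (m r : ℕ) :
    r + 1 ≤ {x ∈ (B : Set X) | μ.1 {x} = (m + 1 : ℕ)}.ncard ↔
      ∃ U ∈ TopologicalSpace.countableBasis X,
        1 ≤ {x ∈ (B : Set X) ∩ U | μ.1 {x} = (m + 1 : ℕ)}.ncard ∧
        r ≤ {x ∈ (B : Set X) \ U | μ.1 {x} = (m + 1 : ℕ)}.ncard := by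
  have hfin := μ.finite_mult B m
  constructor
  · intro h
    obtain ⟨x, hx⟩ : {x ∈ (B : Set X) | μ.1 {x} = (m + 1 : ℕ)}.Nonempty :=
      (Set.ncard_pos hfin).1 (by omega)
    obtain ⟨U, hU, hxU, hUS⟩ := (TopologicalSpace.isBasis_countableBasis X).exists_subset_of_mem_open
      (show x ∈ ({x ∈ (B : Set X) | μ.1 {x} = (m + 1 : ℕ)} \ {x})ᶜ from fun h => h.2 rfl)
      (hfin.subset Set.sdiff_subset).isClosed.isOpen_compl
    refine ⟨U, hU, ?_, ?_⟩
    · exact (Set.ncard_pos (hfin.subset fun y hy => ⟨hy.1.1, hy.2⟩)).2 ⟨x, ⟨hx.1, hxU⟩, hx.2⟩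
    · have h1 := Set.ncard_sdiff_singleton_add_one hx hfin
      have h2 : {x ∈ (B : Set X) | μ.1 {x} = (m + 1 : ℕ)} \ {x} ⊆
          {x ∈ (B : Set X) \ U | μ.1 {x} = (m + 1 : ℕ)} := fun y hy =>
        ⟨⟨hy.1.1, fun hyU => hUS hyU hy⟩, hy.1.2⟩
      have h3 := Set.ncard_le_ncard h2 (hfin.subset fun y hy => ⟨hy.1.1, hy.2⟩)
      omega
  · rintro ⟨U, -, h1, h2⟩
    have h3 : {x ∈ (B : Set X) | μ.1 {x} = (m + 1 : ℕ)} =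
        {x ∈ (B : Set X) ∩ U | μ.1 {x} = (m + 1 : ℕ)} ∪
          {x ∈ (B : Set X) \ U | μ.1 {x} = (m + 1 : ℕ)} := by
      ext y
      by_cases hy : y ∈ U <;> simp [hy]
    rw [h3, Set.ncard_union_eq (Set.disjoint_left.2 fun y hy hy' => hy'.1.2 hy.1.2)
      (hfin.subset fun y hy => ⟨hy.1.1, hy.2⟩) (hfin.subset fun y hy => ⟨hy.1.1, hy.2⟩)]
    omega

/-- "At least one site of multiplicity `m + 1` in `B`" is the complement of a void event; higher
counts follow by induction, and `μ(B)` is the sum of the counts weighted by multiplicity. -/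
theorem generateFrom_voidSystem :
    MeasurableSpace.generateFrom (voidSystem X) = instMeasurableSpace := by
  refine le_antisymm (MeasurableSpace.generateFrom_le ?_) (iSup_le fun B => ?_)
  · rintro _ ⟨B, C, hC, -, rfl⟩
    exact measurableSet_void hC
  have hge : ∀ (r m : ℕ) (B : BddBorel X),
      MeasurableSet[MeasurableSpace.generateFrom (voidSystem X)]
        {μ : PointMeasure X | r ≤ {x ∈ (B : Set X) | μ.1 {x} = (m + 1 : ℕ)}.ncard} := by
    intro r m
    have h1 : ∀ B : BddBorel X, MeasurableSet[MeasurableSpace.generateFrom (voidSystem X)]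
        {μ : PointMeasure X | 1 ≤ {x ∈ (B : Set X) | μ.1 {x} = (m + 1 : ℕ)}.ncard} := by
      intro B
      convert MeasurableSet.compl (MeasurableSpace.measurableSet_generateFrom
        (show void (fun j => if j = m then (B : Set X) else ∅) ∈ voidSystem X from
          ⟨B, _, fun j => by by_cases hj : j = m <;> simp [hj, B.2.1],
            fun j => by by_cases hj : j = m <;> simp [hj], rfl⟩)) using 1
      ext μ
      have := Set.ncard_pos (μ.finite_mult B m)
      rw [Set.mem_ofPred_eq, Nat.one_le_iff_ne_zero, ← Nat.pos_iff_ne_zero, this]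
      simp only [void, Set.mem_compl_iff, Set.mem_ofPred_eq, not_forall, Set.Nonempty]
      constructor
      · rintro ⟨x, hx, hm⟩
        exact ⟨m, x, by simpa using hx, by simpa using hm⟩
      · rintro ⟨j, x, hx, hm⟩
        by_cases hj : j = m
        · subst hj
          exact ⟨x, by simpa using hx, by simpa using hm⟩
        · simp [hj] at hx
    induction r with
    | zero => intro B; simp
    | succ r ih =>
      intro B
      simp_rw [succ_le_ncard_mult_iff]
      have : {μ : PointMeasure X | ∃ U ∈ TopologicalSpace.countableBasis X,
          1 ≤ {x ∈ (B : Set X) ∩ U | μ.1 {x} = (m + 1 : ℕ)}.ncard ∧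
          r ≤ {x ∈ (B : Set X) \ U | μ.1 {x} = (m + 1 : ℕ)}.ncard} =
          ⋃ U ∈ TopologicalSpace.countableBasis X,
            {μ : PointMeasure X | 1 ≤ {x ∈ (B : Set X) ∩ U | μ.1 {x} = (m + 1 : ℕ)}.ncard} ∩
            {μ : PointMeasure X | r ≤ {x ∈ (B : Set X) \ U | μ.1 {x} = (m + 1 : ℕ)}.ncard} := by
        ext μ
        simp only [Set.mem_iUnion, Set.mem_inter_iff, Set.mem_ofPred_eq, exists_prop]
      rw [this]
      refine MeasurableSet.biUnion (TopologicalSpace.countable_countableBasis X) fun U hU => ?_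
      have hUm := (TopologicalSpace.isOpen_of_mem_countableBasis hU).measurableSet
      exact MeasurableSet.inter
        (h1 ⟨B ∩ U, B.2.1.inter hUm, B.2.2.subset Set.inter_subset_left⟩)
        (ih ⟨B \ U, B.2.1.diff hUm, B.2.2.subset Set.sdiff_subset⟩)
  have hN : ∀ m, Measurable[MeasurableSpace.generateFrom (voidSystem X)]
      fun μ : PointMeasure X => {x ∈ (B : Set X) | μ.1 {x} = (m + 1 : ℕ)}.ncard := by
    intro m
    refine @measurable_to_countable' _ _ _ _ (_) _ fun n => ?_
    convert MeasurableSet.diff (hge n m B) (hge (n + 1) m B) using 1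
    ext μ
    simp only [Set.mem_preimage, Set.mem_singleton_iff, Set.mem_sdiff, Set.mem_ofPred_eq]
    omega
  have heval : eval B = fun μ : PointMeasure X => ∑' m : ℕ, ((m + 1 : ℕ) : ℝ≥0∞) *
      {x ∈ (B : Set X) | μ.1 {x} = (m + 1 : ℕ)}.ncard :=
    funext fun μ => measure_eq_tsum_mult μ B
  rw [← measurable_iff_comap_le, heval]
  refine @Measurable.tsum _ _ _ (MeasurableSpace.generateFrom (voidSystem X)) _ _ _ _ _ _ _ _
    (SummationFilter.unconditional ℕ) _ _ _ fun m => ?_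
  exact @Measurable.const_mul _ _ _ _ _ (_) _
    ((measurable_of_countable (fun n : ℕ => (n : ℝ≥0∞))).comp (hN m)) _

end PointMeasure

theorem ext_of_void {P Q : Measure (PointMeasure X)} [IsFiniteMeasure P]
    (huniv : P Set.univ = Q Set.univ)
    (h : ∀ (B : BddBorel X) (C : ℕ → Set X), (∀ m, MeasurableSet (C m)) → (∀ m, C m ⊆ B) →
      P (void C) = Q (void C)) : P = Q := by
  refine ext_of_generate_finite _ generateFrom_voidSystem.symm isPiSystem_voidSystem ?_ huniv
  rintro _ ⟨B, C, hC, hCB, rfl⟩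
  exact h B C hC hCB

end VoidSystem

end PolyaSum

/-! ### The integral equation iterated over multiplicities -/

namespace PolyaSum

open PointMeasure

section Mecke

variable {X : Type*} [MetricSpace X] [MeasurableSpace X]

namespace PointMeasure

/-- `μ + n δ_x`. -/
noncomputable def addMass (μ : PointMeasure X) (x : X) (n : ℕ) : PointMeasure X :=
  ⟨μ.1 + (n : ℝ≥0∞) • Measure.dirac x, fun B => by
    classical
    obtain ⟨k, hk⟩ := μ.2 B
    by_cases hx : x ∈ (B : Set X)
    · exact ⟨k + n, by simp [hk, Measure.dirac_apply' x B.2.1, hx]⟩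
    · exact ⟨k, by simp [hk, Measure.dirac_apply' x B.2.1, hx]⟩⟩

@[simp]
theorem toMeasure_addMass (μ : PointMeasure X) (x : X) (n : ℕ) :
    (μ.addMass x n).1 = μ.1 + (n : ℝ≥0∞) • Measure.dirac x := rfl

@[simp]
theorem toMeasure_addDirac (μ : PointMeasure X) (x : X) :
    (μ.addDirac x).1 = μ.1 + Measure.dirac x := rfl

theorem addMass_one (μ : PointMeasure X) (x : X) : μ.addMass x 1 = μ.addDirac x := by
  ext1; simp

theorem addMass_add (μ : PointMeasure X) (x : X) (m n : ℕ) :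
    (μ.addMass x m).addMass x n = μ.addMass x (m + n) := by
  ext1; simp [add_smul, add_assoc]

theorem addMass_comm (μ : PointMeasure X) (x y : X) (m n : ℕ) :
    (μ.addMass x m).addMass y n = (μ.addMass y n).addMass x m := by
  ext1; simp [add_right_comm]

@[fun_prop]
theorem measurable_addMass {α : Type*} [MeasurableSpace α] {f : α → PointMeasure X} {g : α → X}
    (hf : Measurable f) (hg : Measurable g) (n : ℕ) :
    Measurable fun a => (f a).addMass (g a) n := by
  refine measurable_iff.2 fun B => ?_
  simp only [toMeasure_addMass, Measure.add_apply, Measure.smul_apply, smul_eq_mul,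
    Measure.dirac_apply' _ B.2.1]
  exact ((measurable_eval B).comp hf).add
    (((measurable_one.indicator B.2.1).comp hg).const_mul _)

variable [BorelSpace X]

theorem mass_addMass_self (μ : PointMeasure X) (x : X) (n : ℕ) :
    (μ.addMass x n).1 {x} = μ.1 {x} + n := by
  simp

theorem mass_addMass_of_ne (μ : PointMeasure X) {x y : X} (h : x ≠ y) (n : ℕ) :
    (μ.addMass x n).1 {y} = μ.1 {y} := by
  simp [h]

theorem mem_void_addMass_iff {μ : PointMeasure X} {x : X} (hx : μ.1 {x} = 0) (m : ℕ)
    (C : ℕ → Set X) : μ.addMass x (m + 1) ∈ void C ↔ μ ∈ void C ∧ x ∉ C m := by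
  constructor
  · refine fun h => ⟨fun j y hy hm => ?_, fun hxm => h m x hxm ?_⟩
    · have hxy : x ≠ y := by
        rintro rfl
        rw [hx] at hm
        exact absurd hm.symm (by simp)
      exact h j y hy (by rw [mass_addMass_of_ne _ hxy, hm])
    · rw [mass_addMass_self, hx, zero_add]
  · rintro ⟨h, hxm⟩ j y hy hm
    by_cases hxy : x = y
    · subst hxy
      rw [mass_addMass_self, hx, zero_add] at hm
      have : m + 1 = j + 1 := by exact_mod_cast hm
      obtain rfl : m = j := by omega
      exact hxm hy
    · exact h j y hy (by rw [← mass_addMass_of_ne _ hxy, hm])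

variable [SecondCountableTopology X]

theorem sites_addMass {μ : PointMeasure X} {x : X} (hx : μ.1 {x} = 0) (m : ℕ) {B : BddBorel X}
    (hxB : x ∈ (B : Set X)) : sites B (μ.addMass x (m + 1)) = sites B μ + 1 := by
  rw [sites, sites, ← Set.ncard_insert_of_notMem (fun h => h.2 hx) (μ.finite_sites B)]
  congr 1
  ext y
  by_cases hxy : x = y
  · subst hxy
    simp [hxB]
  · simp [hxy, Ne.symm hxy]

theorem ae_mass_eq_zero {σ : Measure X} (hdiff : ∀ x, σ {x} = 0) (μ : PointMeasure X) :
    ∀ᵐ x ∂σ, μ.1 {x} = 0 := by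
  have h : σ {x | μ.1 {x} ≠ 0} = 0 := by
    have : NullSingletonClass σ := ⟨hdiff⟩
    exact μ.countable_support.measure_zero σ
  exact h

end PointMeasure

variable [BorelSpace X]

theorem measurable_lintegral_config {h : X × PointMeasure X → ℝ≥0∞} (hh : Measurable h) :
    Measurable fun μ : PointMeasure X => ∫⁻ x, h (x, μ) ∂μ.1 :=
  measurable_lintegral measurable_id (f := fun q : PointMeasure X × X => h q.swap)
    (hh.comp measurable_swap)

variable [SecondCountableTopology X] {z : ℝ} {σ : Measure X}
  {Q : Measure (PointMeasure X)}

variable (X) in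
/-- The pairs `(x, μ)` such that `μ` has multiplicity `n` at `x`. -/
def multSet (n : ℕ) : Set (X × PointMeasure X) := {p | p.2.1 {p.1} = n}

theorem measurableSet_multSet (n : ℕ) : MeasurableSet (multSet X n) :=
  measurable_mass (measurableSet_singleton _)

/-- As `σ` is diffuse, the `σ`-term adds a point at an empty site, so it contributes to multiplicity
one only; the `μ`-term raises an existing multiplicity by one. Hence multiplicity one sees only `σ`,
and each higher multiplicity reduces to the previous one at the cost of a factor `z`. -/
theorem IsPolyaSumProcess.lintegral_mult (hQ : IsPolyaSumProcess z σ Q) (hσ : ∀ x, σ {x} = 0)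
    (m : ℕ) {h : X × PointMeasure X → ℝ≥0∞} (hh : Measurable h) :
    ∫⁻ μ, ∫⁻ x, (multSet X (m + 1)).indicator h (x, μ) ∂μ.1 ∂Q =
      ENNReal.ofReal z ^ (m + 1) * ∫⁻ μ, ∫⁻ x, h (x, μ.addMass x (m + 1)) ∂σ ∂Q := by
  induction m generalizing h with
  | zero =>
    rw [hQ.2 _ (hh.indicator (measurableSet_multSet 1)), zero_add, pow_one]
    congr 1
    refine lintegral_congr fun μ => ?_
    rw [lintegral_add_measure, lintegral_congr_ae (g := fun x => h (x, μ.addMass x 1)),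
      lintegral_congr_ae (μ := μ.1) (g := fun _ => 0), lintegral_zero, add_zero]
    · filter_upwards [μ.ae_mass_ne_zero] with x hx
      rw [Set.indicator_of_notMem]
      obtain ⟨n, hn⟩ := μ.exists_mass_eq x
      simpa [multSet, hn] using hx
    · filter_upwards [μ.ae_mass_eq_zero hσ] with x hx
      rw [Set.indicator_of_mem, addMass_one]
      simp [multSet, hx]
  | succ m ih =>
    have hh' : Measurable fun p : X × PointMeasure X => h (p.1, p.2.addMass p.1 1) := by
      fun_prop
    have := ih hh'
    simp_rw [addMass_add, add_comm (m + 1) 1] at this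
    rw [hQ.2 _ (hh.indicator (measurableSet_multSet _)), pow_succ', mul_assoc,
      add_comm (m + 1) 1, add_comm m 1]
    rw [add_comm m 1] at this
    rw [← this]
    congr 1
    refine lintegral_congr fun μ => ?_
    rw [lintegral_add_measure, lintegral_congr_ae (μ := σ) (g := fun _ => 0), lintegral_zero,
      zero_add]
    · refine lintegral_congr fun x => ?_
      obtain ⟨n, hn⟩ := μ.exists_mass_eq x
      have h1 : (x, μ.addDirac x) ∈ multSet X (1 + (1 + m)) ↔ (x, μ) ∈ multSet X (1 + m) := by
        change (μ.addDirac x).1 {x} = _ ↔ μ.1 {x} = _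
        rw [← addMass_one, mass_addMass_self, hn]
        norm_cast
        omega
      by_cases h2 : (x, μ) ∈ multSet X (1 + m)
      · rw [Set.indicator_of_mem h2, Set.indicator_of_mem (h1.2 h2), addMass_one]
      · rw [Set.indicator_of_notMem h2, Set.indicator_of_notMem fun h3 => h2 (h1.1 h3)]
    · filter_upwards [μ.ae_mass_eq_zero hσ] with x hx
      rw [Set.indicator_of_notMem]
      change ¬ (μ.addDirac x).1 {x} = _
      rw [← addMass_one, mass_addMass_self, hx, zero_add]
      norm_cast
      omega

variable (z) in
/-- The mass `z ^ (m + 1) / (m + 1)` that the Lévy measure gives to multiplicity `m + 1`. -/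
noncomputable def weight (m : ℕ) : ℝ≥0∞ := ENNReal.ofReal z ^ (m + 1) / (m + 1 : ℕ)

variable (z σ) in
/-- The mass that the Lévy measure gives to the sets `C m × {m + 1}`. -/
noncomputable def levy (C : ℕ → Set X) : ℝ≥0∞ := ∑' m, weight z m * σ (C m)

theorem sites_mul_eq_tsum (B : BddBorel X) (F : PointMeasure X → ℝ≥0∞) (μ : PointMeasure X) :
    sites B μ * F μ = ∑' m : ℕ, ∫⁻ x, (multSet X (m + 1)).indicator (fun q =>
      ((m + 1 : ℕ) : ℝ≥0∞)⁻¹ * (B : Set X).indicator (fun _ => F q.2) q.1) (x, μ) ∂μ.1 := by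
  have hmult : ∀ m : ℕ, Measurable fun x => (multSet X (m + 1)).indicator (fun q =>
      ((m + 1 : ℕ) : ℝ≥0∞)⁻¹ * (B : Set X).indicator (fun _ => F q.2) q.1) (x, μ) := fun m =>
    Measurable.indicator (s := (fun x => (x, μ)) ⁻¹' multSet X (m + 1))
      (f := fun x => ((m + 1 : ℕ) : ℝ≥0∞)⁻¹ * (B : Set X).indicator (fun _ => F μ) x)
      ((measurable_const.indicator B.2.1).const_mul _)
      (measurable_prodMk_right (measurableSet_multSet _))
  rw [sites_eq_lintegral, ← lintegral_mul_const, ← lintegral_indicator B.2.1,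
    ← lintegral_tsum fun m => (hmult m).aemeasurable]
  · refine lintegral_congr_ae ?_
    filter_upwards [μ.ae_mass_ne_zero] with x hx
    obtain ⟨n, hn⟩ := μ.exists_mass_eq x
    obtain ⟨k, rfl⟩ := Nat.exists_eq_succ_of_ne_zero (n := n) (by
      rintro rfl
      exact hx (by simpa using hn))
    rw [tsum_eq_single k]
    · rw [Set.indicator_of_mem (s := multSet X (k + 1)) hn]
      by_cases hxB : x ∈ (B : Set X) <;> simp [hxB, hn]
    · intro j hj
      rw [Set.indicator_of_notMem]
      simp only [multSet, hn, Set.mem_ofPred_eq]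
      norm_cast
      omega
  · exact (measurable_mass.comp measurable_prodMk_right).inv

/-- Counting a site once instead of `m + 1` times divides `z ^ (m + 1)` by `m + 1`; this is where
the logarithmic weights come from. -/
theorem IsPolyaSumProcess.lintegral_sites (hQ : IsPolyaSumProcess z σ Q) (hσ : ∀ x, σ {x} = 0)
    (B : BddBorel X) {F : PointMeasure X → ℝ≥0∞} (hF : Measurable F) :
    ∫⁻ μ, sites B μ * F μ ∂Q =
      ∑' m, weight z m * ∫⁻ μ, ∫⁻ x in B, F (μ.addMass x (m + 1)) ∂σ ∂Q := by
  have hind : ∀ m : ℕ, Measurable fun q : X × PointMeasure X =>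
      ((m + 1 : ℕ) : ℝ≥0∞)⁻¹ * (B : Set X).indicator (fun _ => F q.2) q.1 := fun m =>
    Measurable.const_mul (Measurable.indicator (s := Prod.fst ⁻¹' (B : Set X))
      (hF.comp measurable_snd) (measurable_fst B.2.1)) _
  simp_rw [sites_mul_eq_tsum]
  rw [lintegral_tsum fun m => (measurable_lintegral_config
    ((hind m).indicator (measurableSet_multSet _))).aemeasurable]
  refine tsum_congr fun m => ?_
  have hc : ((m + 1 : ℕ) : ℝ≥0∞)⁻¹ ≠ ∞ := ENNReal.inv_ne_top.2 (by simp)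
  have hin : ∀ μ : PointMeasure X, ∫⁻ x, ((m + 1 : ℕ) : ℝ≥0∞)⁻¹ *
      (B : Set X).indicator (fun _ => F (μ.addMass x (m + 1))) x ∂σ =
      ((m + 1 : ℕ) : ℝ≥0∞)⁻¹ * ∫⁻ x in B, F (μ.addMass x (m + 1)) ∂σ := fun μ => by
    rw [lintegral_const_mul' _ _ hc, ← lintegral_indicator B.2.1]
    simp only [Set.indicator]
  rw [hQ.lintegral_mult hσ m (hind m), weight, ENNReal.div_eq_inv_mul, mul_comm _⁻¹, mul_assoc,
    lintegral_congr hin, lintegral_const_mul' _ _ hc]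

/-- The recursion `(n + 1) p_{n+1} = λ p_n` of the Poisson distribution: adding a site of
multiplicity `m + 1` at an empty `x ∈ B` leads into the event exactly if `x ∉ C m` and the old
configuration was in the event with one site fewer. -/
theorem IsPolyaSumProcess.measure_void_sites_succ (hQ : IsPolyaSumProcess z σ Q)
    (hσ : ∀ x, σ {x} = 0) (B : BddBorel X) {C : ℕ → Set X}
    (hC : ∀ m, MeasurableSet (C m)) (n : ℕ) :
    (n + 1 : ℕ) * Q (void C ∩ {μ | sites B μ = n + 1}) =
      levy z σ (fun m => B \ C m) * Q (void C ∩ {μ | sites B μ = n}) := by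
  have hm : ∀ n, MeasurableSet (void C ∩ {μ | sites B μ = n}) := fun n =>
    (measurableSet_void hC).inter (measurable_sites B (measurableSet_singleton n))
  have h := hQ.lintegral_sites hσ B (measurable_one.indicator (hm (n + 1)))
  have hl : ∀ μ : PointMeasure X, (sites B μ : ℝ≥0∞) *
      (void C ∩ {μ | sites B μ = n + 1}).indicator 1 μ =
      (void C ∩ {μ | sites B μ = n + 1}).indicator (fun _ => ((n + 1 : ℕ) : ℝ≥0∞)) μ := by
    intro μ
    by_cases hμ : μ ∈ void C ∩ {μ | sites B μ = n + 1}
    · rw [Set.indicator_of_mem hμ, Set.indicator_of_mem hμ, hμ.2]; simp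
    · simp [Set.indicator_of_notMem hμ]
  simp_rw [hl] at h
  rw [lintegral_indicator_const (hm _)] at h
  rw [h, levy, ← ENNReal.tsum_mul_right]
  refine tsum_congr fun m => ?_
  rw [mul_assoc]
  congr 1
  have hr : ∀ μ : PointMeasure X, ∫⁻ x in B, (void C ∩ {μ | sites B μ = n + 1}).indicator 1
      (μ.addMass x (m + 1)) ∂σ =
      (void C ∩ {μ | sites B μ = n}).indicator (fun _ => σ (B \ C m)) μ := by
    intro μ
    have h1 : ∀ᵐ x ∂σ.restrict B, (void C ∩ {μ | sites B μ = n + 1}).indicator 1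
        (μ.addMass x (m + 1)) = (C m)ᶜ.indicator (fun _ =>
          (void C ∩ {μ | sites B μ = n}).indicator (1 : PointMeasure X → ℝ≥0∞) μ) x := by
      filter_upwards [ae_restrict_mem B.2.1, ae_restrict_of_ae (μ.ae_mass_eq_zero hσ)] with x hxB hx
      have : μ.addMass x (m + 1) ∈ void C ∩ {μ | sites B μ = n + 1} ↔
          x ∈ (C m)ᶜ ∧ μ ∈ void C ∩ {μ | sites B μ = n} := by
        simp only [Set.mem_inter_iff, mem_void_addMass_iff hx, Set.mem_ofPred_eq,
          sites_addMass hx m hxB, Set.mem_compl_iff]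
        constructor
        · exact fun h => ⟨h.1.2, h.1.1, by omega⟩
        · exact fun h => ⟨⟨h.2.1, h.1⟩, by omega⟩
      by_cases h1 : x ∈ (C m)ᶜ <;> by_cases h2 : μ ∈ void C ∩ {μ | sites B μ = n} <;>
        simp only [Set.indicator, this, h1, h2, and_true, and_false, if_true, if_false,
          Pi.one_apply]
    rw [lintegral_congr_ae h1, lintegral_indicator_const (hC m).compl,
      Measure.restrict_apply (hC m).compl, Set.inter_comm _ (B : Set X), ← Set.sdiff_eq]
    by_cases h2 : μ ∈ void C ∩ {μ | sites B μ = n} <;> simp [Set.indicator, h2]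
  simp_rw [hr]
  rw [lintegral_indicator_const (hm _)]

end Mecke

end PolyaSum

/-! ### Void probabilities and uniqueness -/

namespace PolyaSum

open PointMeasure

section Law

theorem ENNReal_tsum_pow_div_factorial {a : ℝ≥0∞} (ha : a ≠ ∞) :
    ∑' n : ℕ, a ^ n / (n.factorial : ℝ≥0∞) = ENNReal.ofReal (Real.exp a.toReal) := by
  lift a to ℝ≥0 using ha
  have h := NormedSpace.expSeries_div_hasSum_exp (a : ℝ)
  rw [← Real.exp_eq_exp_ℝ] at h
  rw [ENNReal.coe_toReal, ← h.tsum_eq, ENNReal.ofReal_tsum_of_nonneg (fun n => by positivity)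
    h.summable]
  refine tsum_congr fun n => ?_
  rw [ENNReal.ofReal_div_of_pos (by positivity), ENNReal.ofReal_pow a.coe_nonneg,
    ENNReal.ofReal_coe_nnreal, ENNReal.ofReal_natCast]

theorem weight_eq_ofReal {z : ℝ} (hz : 0 ≤ z) (m : ℕ) :
    weight z m = ENNReal.ofReal (z ^ (m + 1) / (m + 1)) := by
  rw [weight, ENNReal.ofReal_div_of_pos (by positivity), ENNReal.ofReal_pow hz]
  congr 1
  rw [← ENNReal.ofReal_natCast]
  push_cast
  rfl

theorem tsum_weight {z : ℝ} (hz0 : 0 < z) (hz1 : z < 1) :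
    ∑' m, weight z m = ENNReal.ofReal (-Real.log (1 - z)) := by
  have h := Real.hasSum_pow_div_log_of_abs_lt_one (x := z) (by rwa [abs_of_pos hz0])
  rw [← h.tsum_eq, ENNReal.ofReal_tsum_of_nonneg (fun n => by positivity) h.summable]
  exact tsum_congr fun m => weight_eq_ofReal hz0.le m

variable {X : Type*} [MeasurableSpace X] {z : ℝ} {σ : Measure X}

theorem levy_const (hz0 : 0 < z) (hz1 : z < 1) (A : Set X) :
    levy z σ (fun _ => A) = ENNReal.ofReal (-Real.log (1 - z)) * σ A := by
  rw [levy, ENNReal.tsum_mul_right, tsum_weight hz0 hz1]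

theorem levy_mono {C D : ℕ → Set X} (h : ∀ m, C m ⊆ D m) : levy z σ C ≤ levy z σ D :=
  ENNReal.tsum_le_tsum fun m => by gcongr; exact h m

theorem levy_smul (w : ℝ≥0∞) (C : ℕ → Set X) : levy z (w • σ) C = w * levy z σ C := by
  rw [levy, levy, ← ENNReal.tsum_mul_left]
  exact tsum_congr fun m => by simp [mul_left_comm]

variable [MetricSpace X] {Q : Measure (PointMeasure X)}

theorem levy_add_levy_sdiff (B : BddBorel X) {C : ℕ → Set X} (hC : ∀ m, MeasurableSet (C m))
    (hCB : ∀ m, C m ⊆ B) :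
    levy z σ C + levy z σ (fun m => B \ C m) = levy z σ fun _ => B := by
  rw [levy, levy, levy, ← ENNReal.tsum_add]
  refine tsum_congr fun m => ?_
  rw [← mul_add]
  nth_rw 1 [← Set.inter_eq_right.2 (hCB m)]
  rw [measure_inter_add_sdiff _ (hC m)]

theorem levy_lt_top (hz0 : 0 < z) (hz1 : z < 1) (hσ : LocallyFinite σ) (B : BddBorel X)
    {C : ℕ → Set X} (hCB : ∀ m, C m ⊆ B) : levy z σ C < ∞ := by
  refine (levy_mono hCB).trans_lt ?_
  rw [levy_const hz0 hz1]
  exact ENNReal.mul_lt_top ENNReal.ofReal_lt_top (hσ B)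

theorem void_empty : void (fun _ : ℕ => (∅ : Set X)) = Set.univ := by
  ext μ; simp [void]

theorem toReal_levy_sdiff (hz0 : 0 < z) (hz1 : z < 1) (hσ : LocallyFinite σ) (B : BddBorel X)
    {C : ℕ → Set X} (hC : ∀ m, MeasurableSet (C m)) (hCB : ∀ m, C m ⊆ B) :
    (levy z σ fun m => B \ C m).toReal = (levy z σ fun _ => B).toReal - (levy z σ C).toReal := by
  rw [← levy_add_levy_sdiff B hC hCB, ENNReal.toReal_add (levy_lt_top hz0 hz1 hσ B hCB).ne
    (levy_lt_top hz0 hz1 hσ B fun _ => Set.sdiff_subset).ne]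
  ring

variable [BorelSpace X] [SecondCountableTopology X]

theorem IsPolyaSumProcess.measure_void_sites_eq_mul (hQ : IsPolyaSumProcess z σ Q)
    (hσ : LocallyFinite σ) (hdiff : ∀ x, σ {x} = 0) (B : BddBorel X) {C : ℕ → Set X}
    (hC : ∀ m, MeasurableSet (C m)) (hCB : ∀ m, C m ⊆ B) (n : ℕ) :
    Q (void C ∩ {μ | sites B μ = n}) =
      levy z σ (fun m => B \ C m) ^ n / (n.factorial : ℝ≥0∞) * Q {μ | sites B μ = 0} := by
  have := hσ.sigmaFinite
  induction n with
  | zero =>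
    -- Without sites in `B` nothing can violate the void condition, since every `C m` lies in `B`.
    have : void C ∩ {μ | sites B μ = 0} = {μ | sites B μ = 0} := by
      refine Set.inter_eq_right.2 fun μ hμ m x hx hm => ?_
      have h0 : {x ∈ (B : Set X) | μ.1 {x} ≠ 0} = ∅ :=
        (Set.ncard_eq_zero (μ.finite_sites B)).1 hμ
      exact Set.eq_empty_iff_forall_notMem.1 h0 x ⟨hCB m hx, by rw [hm]; simp⟩
    simp [this]
  | succ n ih =>
    have h := hQ.measure_void_sites_succ hdiff B hC n
    rw [ih] at h
    have hn : ((n + 1 : ℕ) : ℝ≥0∞) ≠ 0 := by simp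
    rw [← ENNReal.eq_div_iff hn (by simp)] at h
    rw [h, Nat.factorial_succ, pow_succ', Nat.cast_mul, ENNReal.div_eq_inv_mul,
      ENNReal.div_eq_inv_mul, ENNReal.div_eq_inv_mul,
      ENNReal.mul_inv (Or.inl hn) (Or.inl (by simp))]
    ring

theorem tsum_measure_inter_sites (Q : Measure (PointMeasure X)) (B : BddBorel X)
    {V : Set (PointMeasure X)} (hV : MeasurableSet V) :
    ∑' n, Q (V ∩ {μ | sites B μ = n}) = Q V := by
  rw [← measure_iUnion, ← Set.inter_iUnion]
  · congr 1
    exact Set.inter_eq_left.2 fun μ _ => Set.mem_iUnion.2 ⟨sites B μ, rfl⟩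
  · exact fun i j hij => Set.disjoint_left.2 fun μ hi hj => hij (hi.2.symm.trans hj.2)
  · exact fun n => hV.inter (measurable_sites B (measurableSet_singleton n))

/-- With `C` empty, the Poisson weights times this probability must sum to one, which fixes the
normalization. -/
theorem IsPolyaSumProcess.measure_sites_eq_zero (hQ : IsPolyaSumProcess z σ Q) (hz0 : 0 < z)
    (hz1 : z < 1) (hσ : LocallyFinite σ) (hdiff : ∀ x, σ {x} = 0) (B : BddBorel X) :
    Q {μ | sites B μ = 0} = ENNReal.ofReal (Real.exp (-(levy z σ fun _ => B).toReal)) := by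
  have := hQ.1
  have hfin := (levy_lt_top hz0 hz1 hσ B (C := fun _ => B) fun _ => subset_rfl).ne
  have h1 := tsum_measure_inter_sites Q B MeasurableSet.univ
  simp_rw [← void_empty, hQ.measure_void_sites_eq_mul hσ hdiff B
    (fun _ => MeasurableSet.empty) (fun _ => Set.empty_subset _)] at h1
  rw [ENNReal.tsum_mul_right, void_empty, measure_univ] at h1
  simp only [Set.sdiff_empty] at h1
  rw [ENNReal_tsum_pow_div_factorial hfin, mul_comm] at h1
  rw [Real.exp_neg, ENNReal.ofReal_inv_of_pos (Real.exp_pos _)]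
  exact ENNReal.eq_inv_of_mul_eq_one_left h1

theorem IsPolyaSumProcess.measure_void_sites (hQ : IsPolyaSumProcess z σ Q) (hz0 : 0 < z)
    (hz1 : z < 1) (hσ : LocallyFinite σ) (hdiff : ∀ x, σ {x} = 0) (B : BddBorel X)
    {C : ℕ → Set X} (hC : ∀ m, MeasurableSet (C m)) (hCB : ∀ m, C m ⊆ B) (n : ℕ) :
    Q (void C ∩ {μ | sites B μ = n}) = ENNReal.ofReal
      (((levy z σ fun _ => B).toReal - (levy z σ C).toReal) ^ n / n.factorial *
        Real.exp (-(levy z σ fun _ => B).toReal)) := by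
  rw [hQ.measure_void_sites_eq_mul hσ hdiff B hC hCB, hQ.measure_sites_eq_zero hz0 hz1 hσ hdiff,
    ← toReal_levy_sdiff hz0 hz1 hσ B hC hCB, ENNReal.ofReal_mul (by positivity),
    ENNReal.ofReal_div_of_pos (by positivity), ENNReal.ofReal_pow (by positivity),
    ENNReal.ofReal_toReal (levy_lt_top hz0 hz1 hσ B fun _ => Set.sdiff_subset).ne,
    ENNReal.ofReal_natCast]

theorem IsPolyaSumProcess.measure_void (hQ : IsPolyaSumProcess z σ Q) (hz0 : 0 < z)
    (hz1 : z < 1) (hσ : LocallyFinite σ) (hdiff : ∀ x, σ {x} = 0) (B : BddBorel X)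
    {C : ℕ → Set X} (hC : ∀ m, MeasurableSet (C m)) (hCB : ∀ m, C m ⊆ B) :
    Q (void C) = ENNReal.ofReal (Real.exp (-(levy z σ C).toReal)) := by
  rw [← tsum_measure_inter_sites Q B (measurableSet_void hC)]
  simp_rw [hQ.measure_void_sites_eq_mul hσ hdiff B hC hCB]
  rw [ENNReal.tsum_mul_right, ENNReal_tsum_pow_div_factorial
    (levy_lt_top hz0 hz1 hσ B fun _ => Set.sdiff_subset).ne,
    hQ.measure_sites_eq_zero hz0 hz1 hσ hdiff, ← ENNReal.ofReal_mul (by positivity), ← Real.exp_add,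
    toReal_levy_sdiff hz0 hz1 hσ B hC hCB]
  congr 2
  ring

theorem IsPolyaSumProcess.unique {Q' : Measure (PointMeasure X)} (hQ : IsPolyaSumProcess z σ Q)
    (hQ' : IsPolyaSumProcess z σ Q') (hz0 : 0 < z) (hz1 : z < 1) (hσ : LocallyFinite σ)
    (hdiff : ∀ x, σ {x} = 0) : Q = Q' := by
  have := hQ.1
  have := hQ'.1
  refine ext_of_void (by simp) fun B C hC hCB => ?_
  rw [hQ.measure_void hz0 hz1 hσ hdiff B hC hCB, hQ'.measure_void hz0 hz1 hσ hdiff B hC hCB]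

end Law

end PolyaSum

/-! ### Existence for finite intensity -/

namespace PolyaSum

open PointMeasure

section Existence

variable {X : Type*} [MetricSpace X] [MeasurableSpace X]

/-- The integral equation for `Poy_{z,σ}` iterated over the multiplicities: the Mecke equation of
the compound Poisson process with Lévy measure `∑ z ^ m / m σ ⊗ δ_m`. -/
def SolvesMecke (z : ℝ) (σ : Measure X) (Q : Measure (PointMeasure X)) : Prop :=
  ∀ h : X × PointMeasure X → ℝ≥0∞, Measurable h →
    ∫⁻ μ, ∫⁻ x, h (x, μ) ∂μ.1 ∂Q =
      ∑' m : ℕ, ENNReal.ofReal z ^ (m + 1) * ∫⁻ μ, ∫⁻ x, h (x, μ.addMass x (m + 1)) ∂σ ∂Q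

variable {z : ℝ} {σ : Measure X}

theorem measurable_lintegral_addMass {α : Type*} [MeasurableSpace α] [SFinite σ]
    {f : α × X × PointMeasure X → ℝ≥0∞} (hf : Measurable f) {g : α → PointMeasure X}
    (hg : Measurable g) (m : ℕ) :
    Measurable fun a => ∫⁻ x, f (a, x, (g a).addMass x m) ∂σ := by
  refine Measurable.lintegral_prod_right'
    (f := fun q : α × X => f (q.1, q.2, (g q.1).addMass q.2 m)) ?_
  fun_prop

section Finite

variable (z σ)

/-- Adding one point to a configuration, distributed according to the Lévy measure. -/
noncomputable def addPoint (F : PointMeasure X → ℝ≥0∞) (μ : PointMeasure X) : ℝ≥0∞ :=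
  ∑' m, weight z m * ∫⁻ y, F (μ.addMass y (m + 1)) ∂σ

/-- The right hand side of the Mecke equation at a configuration. -/
noncomputable def meckeSum (h : X × PointMeasure X → ℝ≥0∞) (μ : PointMeasure X) : ℝ≥0∞ :=
  ∑' m : ℕ, ENNReal.ofReal z ^ (m + 1) * ∫⁻ x, h (x, μ.addMass x (m + 1)) ∂σ

/-- The (unnormalized) law of a configuration of `n` points. -/
noncomputable def pointLaw : ℕ → Measure (PointMeasure X)
  | 0 => Measure.dirac ⟨0, fun _ => ⟨0, by simp⟩⟩
  | n + 1 => Measure.sum fun m : ℕ => weight z m •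
      ((pointLaw n).prod σ).map fun p => p.1.addMass p.2 (m + 1)

variable {z σ} [SFinite σ]

theorem measurable_addPoint {F : X × PointMeasure X → ℝ≥0∞} (hF : Measurable F) :
    Measurable fun p : X × PointMeasure X => addPoint z σ (fun μ => F (p.1, μ)) p.2 := by
  refine Measurable.tsum fun m => Measurable.const_mul ?_ _
  exact measurable_lintegral_addMass (f := fun q : (X × PointMeasure X) × X × PointMeasure X =>
    F (q.1.1, q.2.2)) (by fun_prop) measurable_snd _

theorem measurable_meckeSum {h : X × PointMeasure X → ℝ≥0∞} (hh : Measurable h) :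
    Measurable (meckeSum z σ h) := by
  refine Measurable.tsum fun m => Measurable.const_mul ?_ _
  exact measurable_lintegral_addMass (f := fun q : PointMeasure X × X × PointMeasure X => h q.2)
    (by fun_prop) measurable_id _

theorem lintegral_pointLaw_succ (n : ℕ) {F : PointMeasure X → ℝ≥0∞} (hF : Measurable F) :
    ∫⁻ μ, F μ ∂pointLaw z σ (n + 1) = ∫⁻ μ, addPoint z σ F μ ∂pointLaw z σ n := by
  have hm : ∀ m : ℕ, Measurable fun p : PointMeasure X × X => F (p.1.addMass p.2 (m + 1)) :=
    fun m => by fun_prop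
  simp only [pointLaw, addPoint]
  rw [lintegral_sum_measure, lintegral_tsum fun m => (Measurable.const_mul
    (hm m).lintegral_prod_right' _).aemeasurable]
  refine tsum_congr fun m => ?_
  rw [lintegral_smul_measure, lintegral_map hF (by fun_prop), lintegral_prod _ (hm m).aemeasurable,
    lintegral_const_mul _ (hm m).lintegral_prod_right', smul_eq_mul]

theorem lintegral_addMass {f : X → ℝ≥0∞} (hf : Measurable f) (μ : PointMeasure X) (y : X) (m : ℕ) :
    ∫⁻ x, f x ∂(μ.addMass y m).1 = ∫⁻ x, f x ∂μ.1 + m * f y := by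
  rw [toMeasure_addMass, lintegral_add_measure, lintegral_smul_measure, lintegral_dirac' _ hf,
    smul_eq_mul]

theorem weight_mul (m : ℕ) : weight z m * (m + 1 : ℕ) = ENNReal.ofReal z ^ (m + 1) :=
  ENNReal.div_mul_cancel (by simp) (by simp)

/-- The order in which two points are added is irrelevant, so this is Tonelli. -/
theorem meckeSum_addPoint {h : X × PointMeasure X → ℝ≥0∞} (hh : Measurable h)
    (μ : PointMeasure X) :
    meckeSum z σ (fun p => addPoint z σ (fun ν => h (p.1, ν)) p.2) μ =
      addPoint z σ (meckeSum z σ h) μ := by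
  have hm : ∀ m j : ℕ, Measurable fun q : X × X =>
      h (q.1, (μ.addMass q.1 (m + 1)).addMass q.2 (j + 1)) := fun m j => by fun_prop
  simp only [addPoint, meckeSum]
  have h1 : ∀ m : ℕ, ENNReal.ofReal z ^ (m + 1) * ∫⁻ x, ∑' j, weight z j *
      ∫⁻ y, h (x, (μ.addMass x (m + 1)).addMass y (j + 1)) ∂σ ∂σ =
      ∑' j, ENNReal.ofReal z ^ (m + 1) * (weight z j *
        ∫⁻ x, ∫⁻ y, h (x, (μ.addMass x (m + 1)).addMass y (j + 1)) ∂σ ∂σ) := fun m => by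
    rw [lintegral_tsum fun j => (Measurable.const_mul
      (hm m j).lintegral_prod_right' _).aemeasurable, ENNReal.tsum_mul_left]
    congr 1
    exact tsum_congr fun j => lintegral_const_mul _ (hm m j).lintegral_prod_right'
  have h2 : ∀ j : ℕ, weight z j * ∫⁻ y, ∑' m : ℕ, ENNReal.ofReal z ^ (m + 1) *
      ∫⁻ x, h (x, (μ.addMass y (j + 1)).addMass x (m + 1)) ∂σ ∂σ =
      ∑' m, weight z j * (ENNReal.ofReal z ^ (m + 1) *
        ∫⁻ y, ∫⁻ x, h (x, (μ.addMass x (m + 1)).addMass y (j + 1)) ∂σ ∂σ) := fun j => by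
    simp_rw [addMass_comm _ _ _ (j + 1)]
    rw [lintegral_tsum fun m => (Measurable.const_mul
      (hm m j).lintegral_prod_left' _).aemeasurable, ENNReal.tsum_mul_left]
    congr 1
    exact tsum_congr fun m => lintegral_const_mul _ (hm m j).lintegral_prod_left'
  simp_rw [h1, h2]
  rw [ENNReal.tsum_comm]
  refine tsum_congr fun j => tsum_congr fun m => ?_
  rw [lintegral_lintegral_swap (hm m j).aemeasurable, mul_left_comm]

theorem pointLaw_univ (n : ℕ) :
    pointLaw z σ n Set.univ = levy z σ (fun _ => Set.univ) ^ n := by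
  induction n with
  | zero => simp [pointLaw]
  | succ n ih =>
    rw [← lintegral_one, lintegral_pointLaw_succ n measurable_const]
    simp only [addPoint, lintegral_const, one_mul]
    rw [ih, levy, pow_succ']

variable [BorelSpace X]

/-- A product rule: the distinguished point is either an old one or the new one. In the second case
the multiplicity `m + 1` turns the weight `z ^ (m + 1) / (m + 1)` into `z ^ (m + 1)`. -/
theorem addPoint_lintegral {h : X × PointMeasure X → ℝ≥0∞} (hh : Measurable h)
    (μ : PointMeasure X) :
    addPoint z σ (fun ν => ∫⁻ x, h (x, ν) ∂ν.1) μ =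
      ∫⁻ x, addPoint z σ (fun ν => h (x, ν)) μ ∂μ.1 + meckeSum z σ h μ := by
  have hm : ∀ m : ℕ, Measurable fun q : X × X => h (q.1, μ.addMass q.2 (m + 1)) :=
    fun m => by fun_prop
  simp only [addPoint, meckeSum]
  rw [lintegral_tsum fun m => (Measurable.const_mul
    (hm m).lintegral_prod_right' _).aemeasurable, ← ENNReal.tsum_add]
  refine tsum_congr fun m => ?_
  have h1 : ∀ y : X, ∫⁻ x, h (x, μ.addMass y (m + 1)) ∂(μ.addMass y (m + 1)).1 =
      ∫⁻ x, h (x, μ.addMass y (m + 1)) ∂μ.1 + (m + 1 : ℕ) * h (y, μ.addMass y (m + 1)) := fun y =>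
    lintegral_addMass (by fun_prop) _ _ _
  simp_rw [h1]
  rw [lintegral_add_left (hm m).lintegral_prod_left', mul_add,
    lintegral_const_mul _ (hm m).lintegral_prod_right', lintegral_const_mul _ (by fun_prop),
    ← mul_assoc _ ((m + 1 : ℕ) : ℝ≥0∞), weight_mul]
  congr 2
  exact (lintegral_lintegral_swap (f := fun x y => h (x, μ.addMass y (m + 1)))
    (hm m).aemeasurable).symm

/-- Each of the `n + 1` points contributes equally: the last one gives one Mecke term directly, the
earlier ones by induction, because adding a point commutes with `meckeSum`. -/
theorem lintegral_config_pointLaw (n : ℕ) {h : X × PointMeasure X → ℝ≥0∞} (hh : Measurable h) :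
    ∫⁻ μ, ∫⁻ x, h (x, μ) ∂μ.1 ∂pointLaw z σ (n + 1) =
      (n + 1 : ℕ) * ∫⁻ μ, meckeSum z σ h μ ∂pointLaw z σ n := by
  have hstep : ∀ (n : ℕ) (h : X × PointMeasure X → ℝ≥0∞), Measurable h →
      ∫⁻ μ, ∫⁻ x, h (x, μ) ∂μ.1 ∂pointLaw z σ (n + 1) =
      ∫⁻ μ, ∫⁻ x, addPoint z σ (fun ν => h (x, ν)) μ ∂μ.1 ∂pointLaw z σ n +
        ∫⁻ μ, meckeSum z σ h μ ∂pointLaw z σ n := fun n h hh => by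
    rw [lintegral_pointLaw_succ n (measurable_lintegral_config hh)]
    simp_rw [addPoint_lintegral hh]
    rw [lintegral_add_right _ (measurable_meckeSum hh)]
  induction n generalizing h with
  | zero =>
    rw [hstep 0 h hh]
    have : ∫⁻ μ, ∫⁻ x, addPoint z σ (fun ν => h (x, ν)) μ ∂μ.1 ∂pointLaw z σ 0 = 0 := by
      rw [pointLaw, lintegral_dirac' _ (measurable_lintegral_config (measurable_addPoint hh))]
      simp
    simp [this]
  | succ n ih =>
    rw [hstep (n + 1) h hh, ih (measurable_addPoint hh)]
    simp_rw [meckeSum_addPoint hh]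
    rw [← lintegral_pointLaw_succ n (measurable_meckeSum hh)]
    push_cast
    ring

/-- The solution is the Poisson mixture `exp (-λ) ∑ pointLaw n / n!`. The factor `n + 1` in
`lintegral_config_pointLaw` turns `1 / (n + 1)!` into `1 / n!`, so the Mecke equation is an index
shift. -/
theorem exists_solvesMecke_of_isFinite (hz0 : 0 < z) (hz1 : z < 1) [IsFiniteMeasure σ] :
    ∃ Q : Measure (PointMeasure X), IsProbabilityMeasure Q ∧ SolvesMecke z σ Q := by
  have hfin : levy z σ (fun _ => Set.univ) ≠ ∞ := by
    rw [levy_const hz0 hz1]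
    exact ENNReal.mul_ne_top ENNReal.ofReal_ne_top (measure_ne_top _ _)
  refine ⟨ENNReal.ofReal (Real.exp (-(levy z σ fun _ => Set.univ).toReal)) •
    Measure.sum fun n : ℕ => ((n.factorial : ℝ≥0∞)⁻¹ • pointLaw z σ n), ⟨?_⟩, fun h hh => ?_⟩
  · rw [Measure.smul_apply, Measure.sum_apply _ MeasurableSet.univ]
    simp_rw [Measure.smul_apply, pointLaw_univ, smul_eq_mul, ← ENNReal.div_eq_inv_mul]
    rw [ENNReal_tsum_pow_div_factorial hfin, ← ENNReal.ofReal_mul (by positivity), ← Real.exp_add]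
    simp
  · have hJ : ∀ Q : Measure (PointMeasure X), ∑' m : ℕ, ENNReal.ofReal z ^ (m + 1) *
        ∫⁻ μ, ∫⁻ x, h (x, μ.addMass x (m + 1)) ∂σ ∂Q = ∫⁻ μ, meckeSum z σ h μ ∂Q := fun Q => by
      have hm : ∀ m : ℕ, Measurable fun μ : PointMeasure X =>
          ∫⁻ x, h (x, μ.addMass x (m + 1)) ∂σ := fun m =>
        measurable_lintegral_addMass (f := fun q : PointMeasure X × X × PointMeasure X => h q.2)
          (by fun_prop) measurable_id _
      simp only [meckeSum]
      rw [lintegral_tsum fun m => ((hm m).const_mul _).aemeasurable]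
      exact tsum_congr fun m => (lintegral_const_mul _ (hm m)).symm
    rw [hJ, lintegral_smul_measure, lintegral_smul_measure, lintegral_sum_measure,
      lintegral_sum_measure, tsum_eq_zero_add' ENNReal.summable]
    congr 1
    simp_rw [lintegral_smul_measure, smul_eq_mul]
    have h0 : ∫⁻ μ, ∫⁻ x, h (x, μ) ∂μ.1 ∂pointLaw z σ 0 = 0 := by
      rw [pointLaw, lintegral_dirac' _ (measurable_lintegral_config hh)]
      simp
    rw [h0, mul_zero, zero_add]
    refine tsum_congr fun n => ?_
    rw [lintegral_config_pointLaw n hh, ← mul_assoc]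
    congr 1
    rw [Nat.factorial_succ, Nat.cast_mul, ENNReal.mul_inv (by simp) (by simp), mul_right_comm,
      ENNReal.inv_mul_cancel (by simp) (by simp), one_mul]

end Finite

variable [BorelSpace X]

/-- Splitting off the first term of the Mecke series leaves `z` times the same series for `h (x, μ +
δ_x)`, which is the `μ`-term of the integral equation. -/
theorem SolvesMecke.isPolyaSumProcess {Q : Measure (PointMeasure X)} [IsProbabilityMeasure Q]
    [SFinite σ] (hQ : SolvesMecke z σ Q) : IsPolyaSumProcess z σ Q := by
  refine ⟨inferInstance, fun h hh => ?_⟩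
  have hh' : Measurable fun p : X × PointMeasure X => h (p.1, p.2.addMass p.1 1) := by fun_prop
  simp_rw [lintegral_add_measure, ← addMass_one]
  rw [lintegral_add_right _ (measurable_lintegral_config hh'), hQ h hh, hQ _ hh', mul_add,
    tsum_eq_zero_add' ENNReal.summable, ← ENNReal.tsum_mul_left]
  simp only [zero_add, pow_one, addMass_add, pow_succ' _ (_ + 1), mul_assoc]

end Existence

end PolyaSum

/-! ### Existence for locally finite intensity by superposition -/

namespace PolyaSum

open PointMeasure

section Superposition

/-- Resampling one coordinate preserves the product law. This lets the equation for cell `k` be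
applied with all other cells frozen. -/
theorem infinitePi_prod_map_update {ι : Type*} [DecidableEq ι] {Y : ι → Type*}
    [∀ i, MeasurableSpace (Y i)] (Q : ∀ i, Measure (Y i)) [∀ i, IsProbabilityMeasure (Q i)]
    (k : ι) :
    ((Measure.infinitePi Q).prod (Q k)).map (fun p => Function.update p.1 k p.2) =
      Measure.infinitePi Q := by
  refine Measure.eq_infinitePi Q fun s t ht => ?_
  have hs : MeasurableSet (Set.pi (s : Set ι) t) :=
    MeasurableSet.pi s.countable_toSet fun i _ => ht i
  rw [Measure.map_apply measurable_update' hs]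
  have : (fun p : (∀ i, Y i) × Y k => Function.update p.1 k p.2) ⁻¹' Set.pi (s : Set ι) t =
      Set.pi ((s.erase k : Finset ι) : Set ι) t ×ˢ (if k ∈ s then t k else Set.univ) := by
    ext p
    simp only [Set.mem_preimage, Set.mem_pi, Set.mem_prod, Finset.coe_erase, Set.mem_sdiff,
      Finset.mem_coe, Set.mem_singleton_iff]
    constructor
    · refine fun h => ⟨fun i hi => by simpa [hi.2] using h i hi.1, ?_⟩
      split_ifs with hk
      · simpa using h k hk
      · trivial
    · rintro ⟨h1, h2⟩ i hi
      by_cases hik : i = k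
      · subst hik
        simpa [hi] using h2
      · simpa [hik] using h1 i ⟨hi, hik⟩
  rw [this, Measure.prod_prod, Measure.infinitePi_pi _ fun i _ => ht i]
  split_ifs with hk
  · rw [mul_comm, Finset.mul_prod_erase s (fun i => Q i (t i)) hk]
  · rw [measure_univ, mul_one, Finset.erase_eq_of_notMem hk]

variable {X : Type*} [MetricSpace X] [MeasurableSpace X]

/-- The superposition of the restrictions of `ω i` to `D i`. -/
noncomputable def superpose (D : ℕ → BddBorel X)
    (hD : ∀ A : Set X, Bornology.IsBounded A → ∃ N, ∀ i, N ≤ i → Disjoint (D i : Set X) A)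
    (ω : ℕ → PointMeasure X) : PointMeasure X :=
  ⟨Measure.sum fun i => (ω i).1.restrict (D i), fun B => by
    obtain ⟨N, hN⟩ := hD B B.2.2
    choose n hn using fun i => (ω i).2
      ⟨B ∩ D i, B.2.1.inter (D i).2.1, B.2.2.subset Set.inter_subset_left⟩
    refine ⟨∑ i ∈ Finset.range N, n i, ?_⟩
    rw [Measure.sum_apply _ B.2.1, tsum_eq_sum (s := Finset.range N)]
    · push_cast
      exact Finset.sum_congr rfl fun i _ => by rw [Measure.restrict_apply B.2.1, ← hn]
    · intro i hi
      rw [Measure.restrict_apply B.2.1,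
        (hN i (by simpa using hi)).symm.inter_eq, measure_empty]⟩

variable {D : ℕ → BddBorel X}
  {hD : ∀ A : Set X, Bornology.IsBounded A → ∃ N, ∀ i, N ≤ i → Disjoint (D i : Set X) A}

theorem measurable_superpose : Measurable (superpose D hD) := by
  refine measurable_iff.2 fun B => ?_
  simp only [superpose, Measure.sum_apply _ B.2.1, Measure.restrict_apply B.2.1]
  exact Measurable.tsum fun i => (measurable_eval
    ⟨B ∩ D i, B.2.1.inter (D i).2.1, B.2.2.subset Set.inter_subset_left⟩).comp
      (measurable_pi_apply i)

theorem superpose_update_addMass (ω : ℕ → PointMeasure X) (k : ℕ) (μ : PointMeasure X) {x : X}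
    (hx : x ∈ (D k : Set X)) (n : ℕ) :
    superpose D hD (Function.update ω k (μ.addMass x n)) =
      (superpose D hD (Function.update ω k μ)).addMass x n := by
  ext A hA
  simp only [superpose, toMeasure_addMass, Measure.add_apply, Measure.sum_apply _ hA,
    Measure.restrict_apply hA]
  have h : ∀ i, (Function.update ω k (μ.addMass x n) i).1 (A ∩ D i) =
      (Function.update ω k μ i).1 (A ∩ D i) +
        if i = k then ((n : ℝ≥0∞) • Measure.dirac x) A else 0 := fun i => by
    by_cases hik : i = k
    · subst hik
      simp only [Function.update_self, toMeasure_addMass, Measure.add_apply, if_true,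
        Measure.smul_apply, Measure.dirac_apply' _ hA,
        Measure.dirac_apply' _ (hA.inter (D i).2.1)]
      congr 2
      by_cases hxA : x ∈ A <;> simp [hxA, hx]
    · simp [hik]
  simp_rw [h]
  rw [ENNReal.tsum_add, tsum_ite_eq]

variable [BorelSpace X] {z : ℝ} {σ : Measure X}

/-- Independent finite solutions are placed in disjoint bounded cells. The integral over `μ` splits
over the cells, and a point added in cell `k` changes the superposition as it changes the `k`-th
component, so the equations of the cells add up. -/
theorem exists_solvesMecke (hz0 : 0 < z) (hz1 : z < 1) (hσ : LocallyFinite σ) :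
    ∃ Q : Measure (PointMeasure X), IsProbabilityMeasure Q ∧ SolvesMecke z σ Q := by
  have := hσ.sigmaFinite
  obtain ⟨D, hdisj, hcov, hD⟩ := exists_disjoint_bounded_cover X
  have hfin : ∀ i, IsFiniteMeasure (σ.restrict (D i)) := fun i => ⟨by simpa using hσ (D i)⟩
  choose Q hQ hmecke using fun i => exists_solvesMecke_of_isFinite (σ := σ.restrict (D i)) hz0 hz1
  set P := Measure.infinitePi Q with hP
  set S := superpose D hD with hS
  have hSm : Measurable S := measurable_superpose
  have hupd : ∀ (k : ℕ) (G : (ℕ → PointMeasure X) → ℝ≥0∞), Measurable G →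
      ∫⁻ ω, G ω ∂P = ∫⁻ ω, ∫⁻ μ, G (Function.update ω k μ) ∂Q k ∂P := fun k G hG => by
    conv_lhs => rw [hP, ← infinitePi_prod_map_update Q k]
    rw [lintegral_map hG measurable_update', lintegral_prod
      (fun p : (ℕ → PointMeasure X) × PointMeasure X => G (Function.update p.1 k p.2))
      (hG.comp measurable_update').aemeasurable]
  refine ⟨P.map S, Measure.isProbabilityMeasure_map hSm.aemeasurable, fun h hh => ?_⟩
  have hH : ∀ m : ℕ, Measurable fun μ : PointMeasure X =>
      ∫⁻ x, h (x, μ.addMass x (m + 1)) ∂σ := fun m =>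
    measurable_lintegral_addMass (f := fun q : PointMeasure X × X × PointMeasure X => h q.2)
      (by fun_prop) measurable_id _
  have hHD : ∀ (k m : ℕ), Measurable fun ω : ℕ → PointMeasure X =>
      ∫⁻ x in D k, h (x, (S ω).addMass x (m + 1)) ∂σ := fun k m =>
    measurable_lintegral_addMass (σ := σ.restrict (D k))
      (f := fun q : (ℕ → PointMeasure X) × X × PointMeasure X => h q.2) (by fun_prop) hSm _
  have hG : ∀ k, Measurable fun ω : ℕ → PointMeasure X =>
      ∫⁻ x, (D k : Set X).indicator (fun x => h (x, S ω)) x ∂(ω k).1 := fun k =>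
    measurable_lintegral (g := fun ω : ℕ → PointMeasure X => ω k) (measurable_pi_apply k)
      (f := fun q : (ℕ → PointMeasure X) × X =>
        (Prod.snd ⁻¹' (D k : Set X)).indicator (fun q => h (q.2, S q.1)) q)
      (Measurable.indicator (by fun_prop) (measurable_snd (D k).2.1))
  have hk : ∀ k, ∫⁻ ω, ∫⁻ x, (D k : Set X).indicator (fun x => h (x, S ω)) x ∂(ω k).1 ∂P =
      ∑' m : ℕ, ENNReal.ofReal z ^ (m + 1) *
        ∫⁻ ω, ∫⁻ x in D k, h (x, (S ω).addMass x (m + 1)) ∂σ ∂P := by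
    intro k
    rw [hupd k _ (hG k)]
    have h1 : ∀ ω : ℕ → PointMeasure X, ∫⁻ μ, ∫⁻ x, (D k : Set X).indicator
        (fun x => h (x, S (Function.update ω k μ))) x ∂(Function.update ω k μ k).1 ∂Q k =
        ∑' m : ℕ, ENNReal.ofReal z ^ (m + 1) * ∫⁻ μ, ∫⁻ x in D k,
          h (x, (S (Function.update ω k μ)).addMass x (m + 1)) ∂σ ∂Q k := by
      intro ω
      have hmeas : Measurable fun p : X × PointMeasure X =>
          (Prod.fst ⁻¹' (D k : Set X)).indicator
            (fun p : X × PointMeasure X => h (p.1, S (Function.update ω k p.2))) p :=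
        Measurable.indicator (hh.comp (measurable_fst.prodMk
          (hSm.comp ((measurable_update ω).comp measurable_snd)))) (measurable_fst (D k).2.1)
      have := hmecke k _ hmeas
      simp only [Function.update_self]
      refine this.trans (tsum_congr fun m => ?_)
      congr 1
      refine lintegral_congr fun μ => setLIntegral_congr_fun (D k).2.1 fun x hx => ?_
      rw [Set.indicator_of_mem (by exact hx)]
      simp only [hS]
      rw [superpose_update_addMass ω k μ hx]
    simp_rw [h1]
    have hm : ∀ m : ℕ, Measurable fun ω : ℕ → PointMeasure X => ∫⁻ μ, ∫⁻ x in D k,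
        h (x, (S (Function.update ω k μ)).addMass x (m + 1)) ∂σ ∂Q k := fun m =>
      Measurable.lintegral_prod_right' (f := fun q : (ℕ → PointMeasure X) × PointMeasure X =>
        ∫⁻ x in D k, h (x, (S (Function.update q.1 k q.2)).addMass x (m + 1)) ∂σ)
        ((hHD k m).comp measurable_update')
    rw [lintegral_tsum fun m => ((hm m).const_mul _).aemeasurable]
    refine tsum_congr fun m => ?_
    rw [lintegral_const_mul _ (hm m), ← hupd k _ (hHD k m)]
  rw [lintegral_map (measurable_lintegral_config hh) hSm]
  have h2 : ∀ ω, ∫⁻ x, h (x, S ω) ∂(S ω).1 =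
      ∑' k, ∫⁻ x, (D k : Set X).indicator (fun x => h (x, S ω)) x ∂(ω k).1 := fun ω => by
    simp_rw [lintegral_indicator (D _).2.1]
    rw [← lintegral_sum_measure]
    rfl
  have h3 : ∀ (μ : PointMeasure X) (m : ℕ), ∫⁻ x, h (x, μ.addMass x (m + 1)) ∂σ =
      ∑' k, ∫⁻ x in D k, h (x, μ.addMass x (m + 1)) ∂σ := fun μ m => by
    rw [← lintegral_iUnion (fun k => (D k).2.1) hdisj, hcov, Measure.restrict_univ]
  simp_rw [h2]
  rw [lintegral_tsum fun k => (hG k).aemeasurable]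
  simp_rw [hk]
  rw [ENNReal.tsum_comm]
  refine tsum_congr fun m => ?_
  rw [ENNReal.tsum_mul_left, lintegral_map (hH m) hSm]
  simp_rw [h3]
  rw [lintegral_tsum fun k => (hHD k m).aemeasurable]

theorem existsUnique_isPolyaSumProcess [SecondCountableTopology X] (hz0 : 0 < z) (hz1 : z < 1)
    (hσ : LocallyFinite σ) (hdiff : ∀ x, σ {x} = 0) : ∃! Q, IsPolyaSumProcess z σ Q := by
  have := hσ.sigmaFinite
  obtain ⟨Q, hQ, hmecke⟩ := exists_solvesMecke hz0 hz1 hσ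
  exact ⟨Q, hmecke.isPolyaSumProcess,
    fun Q' hQ' => hQ'.unique hmecke.isPolyaSumProcess hz0 hz1 hσ hdiff⟩

theorem isPolyaSumProcess_polya [SecondCountableTopology X] (hz0 : 0 < z) (hz1 : z < 1)
    (hσ : LocallyFinite σ) (hdiff : ∀ x, σ {x} = 0) : IsPolyaSumProcess z σ (polya z σ) := by
  have h := (existsUnique_isPolyaSumProcess hz0 hz1 hσ hdiff).exists
  rw [polya, dif_pos h]
  exact h.choose_spec

end Superposition

end PolyaSum

/-! ### Reverse martingale convergence -/

namespace PolyaSum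

section ReverseMartingale

variable {Ω : Type*} {m0 : MeasurableSpace Ω} {P : Measure Ω} [IsProbabilityMeasure P]
  {G : ℕ → MeasurableSpace Ω} {φ : Ω → ℝ}

theorem memLp_condExp_of_abs_le_one (hφ : ∀ᵐ ω ∂P, |φ ω| ≤ 1) (n : ℕ) (p : ℝ≥0∞) :
    MemLp (P[φ | G n]) p P := by
  refine MemLp.of_bound integrable_condExp.1 1 ?_
  simpa using ae_bdd_abs_condExp_of_ae_bdd_abs (m := G n) hφ

/-- Pythagoras: the difference is orthogonal to the conditional expectation on the coarser field. -/
theorem integral_sub_sq_condExp (hG : Antitone G) (hG0 : ∀ n, G n ≤ m0)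
    (hφ : ∀ᵐ ω ∂P, |φ ω| ≤ 1) {m n : ℕ} (hmn : m ≤ n) :
    ∫ ω, (P[φ | G m] ω - P[φ | G n] ω) ^ 2 ∂P =
      ∫ ω, P[φ | G m] ω ^ 2 ∂P - ∫ ω, P[φ | G n] ω ^ 2 ∂P := by
  have h2 := fun n => memLp_condExp_of_abs_le_one (G := G) hφ n 2
  have hmul : Integrable (P[φ | G n] * P[φ | G m]) P := (h2 n).integrable_mul (h2 m)
  have h : ∫ ω, P[φ | G n] ω * P[φ | G m] ω ∂P = ∫ ω, P[φ | G n] ω ^ 2 ∂P := by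
    have h1 := condExp_mul_of_stronglyMeasurable_left (m := G n) (μ := P)
      stronglyMeasurable_condExp hmul integrable_condExp
    have h3 := condExp_condExp_of_le (f := φ) (μ := P) (hG hmn) (hG0 m)
    calc ∫ ω, P[φ | G n] ω * P[φ | G m] ω ∂P = ∫ ω, P[P[φ | G n] * P[φ | G m] | G n] ω ∂P :=
          (integral_condExp (hG0 n)).symm
      _ = ∫ ω, P[φ | G n] ω ^ 2 ∂P := by
          refine integral_congr_ae ?_
          filter_upwards [h1, h3] with ω e1 e3
          rw [e1, Pi.mul_apply, e3, sq]
  have he : ∀ ω, (P[φ | G m] ω - P[φ | G n] ω) ^ 2 = P[φ | G m] ω ^ 2 -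
      2 * (P[φ | G n] ω * P[φ | G m] ω) + P[φ | G n] ω ^ 2 := fun ω => by ring
  simp_rw [he]
  have hmul' : Integrable (fun ω => 2 * (P[φ | G n] ω * P[φ | G m] ω)) P := hmul.const_mul 2
  have hsub : Integrable (fun ω => P[φ | G m] ω ^ 2 - 2 * (P[φ | G n] ω * P[φ | G m] ω)) P :=
    (h2 m).integrable_sq.sub hmul'
  rw [integral_add hsub (h2 n).integrable_sq, integral_sub (h2 m).integrable_sq hmul',
    integral_const_mul, h]
  ring

/-- The second moments decrease and are nonnegative, hence Cauchy; by Pythagoras the conditional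
expectations are Cauchy in `L²`, and so in `L¹`. -/
theorem exists_integral_abs_sub_condExp_le (hG : Antitone G) (hG0 : ∀ n, G n ≤ m0)
    (hφ : ∀ᵐ ω ∂P, |φ ω| ≤ 1) {ε : ℝ} (hε : 0 < ε) :
    ∃ N, ∀ m n, N ≤ m → m ≤ n → ∫ ω, |P[φ | G m] ω - P[φ | G n] ω| ∂P ≤ ε := by
  have h2 := fun n => memLp_condExp_of_abs_le_one (G := G) hφ n 2
  have h1 := fun n => memLp_condExp_of_abs_le_one (G := G) hφ n 1
  have hanti : Antitone fun n => ∫ ω, P[φ | G n] ω ^ 2 ∂P := fun m n hmn => by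
    have := integral_sub_sq_condExp hG hG0 hφ hmn
    have h0 : 0 ≤ ∫ ω, (P[φ | G m] ω - P[φ | G n] ω) ^ 2 ∂P := integral_nonneg fun ω => sq_nonneg _
    simp only
    linarith
  have hlim := tendsto_atTop_ciInf hanti ⟨0, by
    rintro _ ⟨n, rfl⟩
    exact integral_nonneg fun ω => sq_nonneg _⟩
  obtain ⟨N, hN⟩ := Metric.cauchySeq_iff.1 hlim.cauchySeq (ε ^ 2) (by positivity)
  refine ⟨N, fun m n hm hmn => ?_⟩
  have hd := hN m hm n (hm.trans hmn)
  rw [Real.dist_eq, ← integral_sub_sq_condExp hG hG0 hφ hmn] at hd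
  have hd := (abs_lt.1 hd).2
  have hsq : Integrable (fun ω => (P[φ | G m] ω - P[φ | G n] ω) ^ 2) P :=
    ((h2 m).sub (h2 n)).integrable_sq
  -- The inequality `|d| ≤ d² / (2ε) + ε / 2` stands in for Cauchy–Schwarz.
  have hle : ∀ ω, |P[φ | G m] ω - P[φ | G n] ω| ≤
      (2 * ε)⁻¹ * (P[φ | G m] ω - P[φ | G n] ω) ^ 2 + ε / 2 := fun ω => by
    generalize P[φ | G m] ω - P[φ | G n] ω = d
    have : (2 * ε)⁻¹ * d ^ 2 + ε / 2 - |d| = (2 * ε)⁻¹ * (|d| - ε) ^ 2 := by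
      rw [← sq_abs d]
      field_simp
      ring
    have h0 : 0 ≤ (2 * ε)⁻¹ * (|d| - ε) ^ 2 := by positivity
    linarith
  calc ∫ ω, |P[φ | G m] ω - P[φ | G n] ω| ∂P
      ≤ ∫ ω, ((2 * ε)⁻¹ * (P[φ | G m] ω - P[φ | G n] ω) ^ 2 + ε / 2) ∂P :=
        integral_mono ((memLp_one_iff_integrable.1 (h1 m)).sub
          (memLp_one_iff_integrable.1 (h1 n))).abs
          ((hsq.const_mul _).add (integrable_const _)) hle
    _ = (2 * ε)⁻¹ * ∫ ω, (P[φ | G m] ω - P[φ | G n] ω) ^ 2 ∂P + ε / 2 := by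
        rw [integral_add (hsq.const_mul _) (integrable_const _), integral_const_mul]
        simp
    _ ≤ (2 * ε)⁻¹ * ε ^ 2 + ε / 2 := by gcongr
    _ = ε := by field_simp; ring

/-- On the finite window from `m` to `n`, time reversal yields an ordinary martingale, to which
Doob's maximal inequality applies. -/
theorem measure_exists_le_abs_sub_condExp (hG : Antitone G) (hG0 : ∀ n, G n ≤ m0)
    (hφ : Integrable φ P) {m n : ℕ} (hmn : m ≤ n) (ε : ℝ≥0) :
    ε * P {ω | ∃ k, m ≤ k ∧ k ≤ n ∧ (ε : ℝ) ≤ |P[φ | G k] ω - P[φ | G n] ω|} ≤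
      ENNReal.ofReal (∫ ω, |P[φ | G m] ω - P[φ | G n] ω| ∂P) := by
  obtain ⟨d, rfl⟩ := Nat.exists_eq_add_of_le hmn
  -- Truncated subtraction keeps the reversed filtration constant after time `d`.
  let ℱ : Filtration ℕ m0 := ⟨fun i => G (m + (d - i)), fun i j hij => hG (by omega),
    fun i => hG0 _⟩
  set ψ : Ω → ℝ := φ - P[φ | G (m + d)]
  have hmart : Martingale (fun i => P[ψ | ℱ i]) ℱ P := martingale_condExp ψ ℱ P
  have hsub : Submartingale (fun i => |P[ψ | ℱ i]|) ℱ P :=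
    hmart.submartingale.sup hmart.neg.submartingale
  have hψ : ∀ i, P[ψ | ℱ i] =ᵐ[P] P[φ | G (m + (d - i))] - P[φ | G (m + d)] := fun i => by
    refine (condExp_sub hφ integrable_condExp _).trans ?_
    have : P[P[φ | G (m + d)] | G (m + (d - i))] = P[φ | G (m + d)] :=
      condExp_of_stronglyMeasurable (hG0 _) (stronglyMeasurable_condExp.mono (hG (by omega)))
        integrable_condExp
    change P[φ | G (m + (d - i))] - P[P[φ | G (m + d)] | G (m + (d - i))] =ᵐ[P] _
    rw [this]
  have hmax := maximal_ineq hsub (fun i ω => abs_nonneg _) (ε := ε) d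
  have hset : {ω | ∃ k, m ≤ k ∧ k ≤ m + d ∧ (ε : ℝ) ≤ |P[φ | G k] ω - P[φ | G (m + d)] ω|} ≤ᵐ[P]
      {ω | (ε : ℝ) ≤ (Finset.range (d + 1)).sup' Finset.nonempty_range_add_one
        fun k => |P[ψ | ℱ k]| ω} := by
    filter_upwards [ae_all_iff.2 hψ] with ω hω
    rintro ⟨k, hk1, hk2, hk⟩
    change (ε : ℝ) ≤ _
    rw [Finset.le_sup'_iff]
    refine ⟨m + d - k, by simp; omega, ?_⟩
    rw [Pi.abs_apply, hω, show m + (d - (m + d - k)) = k by omega]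
    exact hk
  refine (mul_le_mul_right (measure_mono_ae hset) _).trans (hmax.trans ?_)
  refine ENNReal.ofReal_le_ofReal ?_
  refine (setIntegral_le_integral (hsub.integrable d) (ae_of_all _ fun ω => abs_nonneg _)).trans ?_
  refine (integral_congr_ae ?_).le
  filter_upwards [hψ d] with ω hω
  rw [Pi.abs_apply, hω]
  simp

/-- Lévy's downward theorem, for bounded functions and without identification of the limit. -/
theorem ae_exists_tendsto_condExp_antitone (hG : Antitone G) (hG0 : ∀ n, G n ≤ m0)
    (hφi : Integrable φ P) (hφ : ∀ᵐ ω ∂P, |φ ω| ≤ 1) :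
    ∀ᵐ ω ∂P, ∃ l, Tendsto (fun n => P[φ | G n] ω) atTop (𝓝 l) := by
  have key : ∀ ε : ℝ≥0, 0 < ε →
      ∀ᵐ ω ∂P, ∃ m, ∀ k, m ≤ k → |P[φ | G k] ω - P[φ | G m] ω| < 2 * ε := by
    intro ε hε
    -- The factor 2 pays for the comparison through the last index `m + n`: if the `k`-th and `m`-th
    -- terms differ by `2ε`, one of them is at least `ε` away from the last term.
    let E : ℕ → ℕ → Set Ω := fun m n =>
      {ω | ∃ k, m ≤ k ∧ k ≤ m + n ∧ 2 * (ε : ℝ) ≤ |P[φ | G k] ω - P[φ | G m] ω|}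
    have hE : ∀ m n, ε * P (E m n) ≤
        ENNReal.ofReal (∫ ω, |P[φ | G m] ω - P[φ | G (m + n)] ω| ∂P) := by
      intro m n
      refine le_trans ?_ (measure_exists_le_abs_sub_condExp hG hG0 hφi (Nat.le_add_right m n) ε)
      gcongr
      rintro ω ⟨k, hk1, hk2, hk⟩
      by_contra hcon
      simp only [Set.mem_ofPred_eq, not_exists, not_and, not_le] at hcon
      have h1 := hcon k hk1 hk2
      have h2 := hcon m le_rfl (by omega)
      have h3 := abs_sub_le (P[φ | G k] ω) (P[φ | G (m + n)] ω) (P[φ | G m] ω)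
      rw [abs_sub_comm (P[φ | G (m + n)] ω)] at h3
      linarith
    have hbound : ∀ δ : ℝ, 0 < δ → ∃ m, ε * P (⋃ n, E m n) ≤ ENNReal.ofReal δ := by
      intro δ hδ
      obtain ⟨N, hN⟩ := exists_integral_abs_sub_condExp_le hG hG0 hφ hδ
      refine ⟨N, ?_⟩
      have hmono : Monotone (E N) := fun a b hab ω ⟨k, h1, h2, h3⟩ => ⟨k, h1, by omega, h3⟩
      rw [hmono.measure_iUnion, ENNReal.mul_iSup]
      exact iSup_le fun n => (hE N n).trans
        (ENNReal.ofReal_le_ofReal (hN N (N + n) le_rfl (by omega)))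
    have hnull : P (⋂ m, ⋃ n, E m n) = 0 := by
      have : ε * P (⋂ m, ⋃ n, E m n) = 0 := by
        refine le_antisymm (ENNReal.le_of_forall_pos_le_add fun δ hδ _ => ?_) zero_le
        obtain ⟨m, hm⟩ := hbound δ hδ
        rw [zero_add]
        refine le_trans ?_ (hm.trans (by simp))
        gcongr
        exact Set.iInter_subset _ m
      simpa [hε.ne'] using this
    refine measure_mono_null (fun ω hω => ?_) hnull
    simp only [Set.mem_compl_iff, Set.mem_ofPred_eq, not_exists, not_forall, not_lt] at hω
    refine Set.mem_iInter.2 fun m => ?_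
    obtain ⟨k, hk1, hk2⟩ := hω m
    exact Set.mem_iUnion.2 ⟨k, k, hk1, by omega, hk2⟩
  have hall := ae_all_iff.2 fun j : ℕ => key (1 / ((j : ℝ≥0) + 1)) (by positivity)
  filter_upwards [hall] with ω hω
  refine cauchySeq_tendsto_of_complete (Metric.cauchySeq_iff'.2 fun ε hε => ?_)
  obtain ⟨j, hj⟩ := exists_nat_one_div_lt (half_pos hε)
  obtain ⟨m, hm⟩ := hω j
  refine ⟨m, fun k hk => ?_⟩
  rw [Real.dist_eq]
  refine (hm k hk).trans ?_
  push_cast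
  linarith

end ReverseMartingale

end PolyaSum

/-! ### The fields `𝒢_B` and the kernels on void events -/

namespace PolyaSum

open PointMeasure

section SiteField

variable {X : Type*} [MetricSpace X] [MeasurableSpace X]

/-- The restriction of a configuration to the complement of `B`. -/
noncomputable def PointMeasure.restrictCompl (B : BddBorel X) (μ : PointMeasure X) :
    PointMeasure X :=
  splice B ⟨0, fun _ => ⟨0, by simp⟩⟩ μ

@[simp]
theorem PointMeasure.toMeasure_splice (B : BddBorel X) (ν μ : PointMeasure X) :
    (splice B ν μ).1 = ν.1.restrict B + μ.1.restrict (B : Set X)ᶜ := rfl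

/-- The mass of `A` outside `B` is the increment from `B` to `A ∪ B`. -/
theorem measurable_restrictCompl (B : BddBorel X) :
    Measurable[outside B] (restrictCompl B) := by
  refine measurable_iff_comap_le.2 ?_
  simp only [instMeasurableSpace, MeasurableSpace.comap_iSup, MeasurableSpace.comap_comp,
    iSup_le_iff]
  intro A
  let A' : BddBorel X := ⟨A ∪ B, A.2.1.union B.2.1, A.2.2.union B.2.2⟩
  have h : eval A ∘ restrictCompl B = fun μ : PointMeasure X => eval A' μ - eval B μ := by
    ext μ
    have h1 : μ.1 (A ∩ (B : Set X)ᶜ) + μ.1 B = μ.1 (A ∪ B) := by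
      rw [← measure_union (Set.disjoint_left.2 fun x hx hxB => hx.2 hxB) B.2.1,
        ← Set.sdiff_eq, Set.sdiff_union_self]
    simp only [Function.comp, eval, restrictCompl, toMeasure_splice, Measure.restrict_zero,
      zero_add, Measure.restrict_apply A.2.1]
    exact ENNReal.eq_sub_of_add_eq (μ.locallyFinite B).ne h1
  rw [h]
  exact le_iSup₂_of_le (f := fun (B' : BddBorel X) (_ : (B : Set X) ⊆ B') =>
    MeasurableSpace.comap (fun μ => eval B' μ - eval B μ) inferInstance) A' Set.subset_union_right
    le_rfl

theorem outside_le (B : BddBorel X) : outside B ≤ instMeasurableSpace :=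
  iSup₂_le fun B' _ => measurable_iff_comap_le.1 ((measurable_eval B').sub (measurable_eval B))

theorem outside_anti {B B' : BddBorel X} (h : (B : Set X) ⊆ B') : outside B' ≤ outside B := by
  refine iSup₂_le fun A hA => ?_
  let _ : MeasurableSpace (PointMeasure X) := outside B
  have hm : ∀ A : BddBorel X, (B : Set X) ⊆ A → Measurable fun μ => eval A μ - eval B μ :=
    fun A hA => measurable_iff_comap_le.2 (le_iSup₂_of_le (f := fun (B' : BddBorel X)
      (_ : (B : Set X) ⊆ B') => MeasurableSpace.comap (fun μ => eval B' μ - eval B μ) inferInstance)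
      A hA le_rfl)
  rw [← measurable_iff_comap_le]
  have : (fun μ : PointMeasure X => eval A μ - eval B' μ) =
      fun μ => (eval A μ - eval B μ) - (eval B' μ - eval B μ) := by
    ext μ
    exact (tsub_tsub_tsub_cancel_right (measure_mono h)).symm
  rw [this]
  exact (hm A (h.trans hA)).sub (hm B' h)

theorem measurable_splice_left (B : BddBorel X) (μ : PointMeasure X) :
    Measurable fun ν => splice B ν μ := by
  refine measurable_iff.2 fun A => ?_
  simp only [toMeasure_splice, Measure.add_apply, Measure.restrict_apply A.2.1]
  exact (measurable_eval ⟨A ∩ B, A.2.1.inter B.2.1,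
    A.2.2.subset Set.inter_subset_left⟩).add_const _

theorem measurable_sites_siteField (B : BddBorel X) : Measurable[siteField B] (sites B) :=
  measurable_iff_comap_le.2 le_sup_right

variable [BorelSpace X] [SecondCountableTopology X]

theorem measurable_sites_outside {B A : BddBorel X} (h : Disjoint (A : Set X) B) :
    Measurable[outside B] (sites A) := by
  have : sites A = sites A ∘ restrictCompl B := by
    ext μ
    simp only [sites, Function.comp, restrictCompl, toMeasure_splice, Measure.restrict_zero,
      zero_add]
    congr 1
    ext x
    refine and_congr_right fun hx => ?_
    rw [Measure.restrict_apply (measurableSet_singleton x), Set.inter_eq_left.2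
      (Set.singleton_subset_iff.2
      (show x ∈ (B : Set X)ᶜ from fun hxB => Set.disjoint_left.1 h hx hxB))]
  rw [this]
  exact (measurable_sites A).comp (measurable_restrictCompl B)

theorem sites_eq_add {B B' : BddBorel X} (h : (B : Set X) ⊆ B') (μ : PointMeasure X) :
    sites B' μ = sites B μ +
      sites ⟨B' \ B, B'.2.1.diff B.2.1, B'.2.2.subset Set.sdiff_subset⟩ μ := by
  have hd : Disjoint {x ∈ (B : Set X) | μ.1 {x} ≠ 0} {x ∈ (B' : Set X) \ B | μ.1 {x} ≠ 0} :=
    Set.disjoint_left.2 fun x hx hx' => hx'.1.2 hx.1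
  rw [sites, sites, sites, ← Set.ncard_union_eq hd (μ.finite_sites B)
    (μ.finite_sites ⟨B' \ B, B'.2.1.diff B.2.1, B'.2.2.subset Set.sdiff_subset⟩)]
  congr 1
  ext x
  by_cases hx : x ∈ (B : Set X)
  · simp [hx, h hx]
  · simp [hx]

theorem siteField_le (B : BddBorel X) : siteField B ≤ instMeasurableSpace :=
  sup_le (outside_le B) (measurable_iff_comap_le.1 (measurable_sites B))

/-- The count in the larger set is the count in the smaller one plus the count in the difference,
and the latter is an outside event. -/
theorem siteField_anti {B B' : BddBorel X} (h : (B : Set X) ⊆ B') :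
    siteField B' ≤ siteField B := by
  refine sup_le ((outside_anti h).trans le_sup_left) ?_
  let _ : MeasurableSpace (PointMeasure X) := siteField B
  rw [← measurable_iff_comap_le, show sites B' = _ from funext (sites_eq_add h)]
  refine (measurable_sites_siteField B).add ?_
  exact (measurable_sites_outside Set.disjoint_sdiff_left).mono le_sup_left le_rfl

theorem splice_mem_void_iff {B : BddBorel X} {C : ℕ → Set X} (hCB : ∀ m, C m ⊆ B)
    (ν μ : PointMeasure X) : splice B ν μ ∈ void C ↔ ν ∈ void C := by
  refine forall_congr' fun m => forall₂_congr fun x hx => ?_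
  have hxB := hCB m hx
  rw [toMeasure_splice, Measure.add_apply, Measure.restrict_apply (measurableSet_singleton x),
    Measure.restrict_apply (measurableSet_singleton x),
    Set.inter_eq_left.2 (Set.singleton_subset_iff.2 hxB)]
  have : {x} ∩ (B : Set X)ᶜ = ∅ := by simpa using hxB
  rw [this, measure_empty, add_zero]

/-- The outside configuration cannot affect a void event inside `B`, so this is a quotient of two
Poisson probabilities in which exponentials and factorials cancel. Positivity of `λ(B)` ensures that
the conditioning event is not null. -/
theorem siteKernel_void {z : ℝ} {ρ : Measure X} (hz0 : 0 < z) (hz1 : z < 1)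
    (hρ : LocallyFinite ρ) (hdiff : ∀ x, ρ {x} = 0) {B : BddBorel X} {C : ℕ → Set X}
    (hC : ∀ m, MeasurableSet (C m)) (hCB : ∀ m, C m ⊆ B)
    (hB : 0 < (levy z ρ fun _ => B).toReal) (μ : PointMeasure X) :
    (siteKernel z ρ B μ).real (void C) =
      (1 - (levy z ρ C).toReal / (levy z ρ fun _ => B).toReal) ^ sites B μ := by
  have hQ := isPolyaSumProcess_polya hz0 hz1 hρ hdiff
  set Q := polya z ρ
  have hpre : (fun ν => splice B ν μ) ⁻¹' void C = void C := by
    ext ν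
    exact splice_mem_void_iff hCB ν μ
  have hle : 0 ≤ (levy z ρ fun _ => B).toReal - (levy z ρ C).toReal := by
    rw [← toReal_levy_sdiff hz0 hz1 hρ B hC hCB]
    positivity
  have h0 : (levy z ρ fun _ => (∅ : Set X)) = 0 := by simp [levy]
  have h1 := hQ.measure_void_sites hz0 hz1 hρ hdiff B (C := fun _ => ∅)
    (fun _ => MeasurableSet.empty) (fun _ => Set.empty_subset _) (sites B μ)
  rw [void_empty, Set.univ_inter, h0, ENNReal.toReal_zero, sub_zero] at h1
  have hs : MeasurableSet {ν : PointMeasure X | sites B ν = sites B μ} :=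
    measurable_sites B (measurableSet_singleton _)
  rw [siteKernel, measureReal_def, Measure.map_apply (measurable_splice_left B μ)
    (measurableSet_void hC), hpre, cond_apply hs,
    Set.inter_comm, hQ.measure_void_sites hz0 hz1 hρ hdiff B hC hCB, h1, ENNReal.toReal_mul,
    ENNReal.toReal_inv, ENNReal.toReal_ofReal (by positivity),
    ENNReal.toReal_ofReal (by positivity)]
  rw [one_sub_div hB.ne', div_pow]
  field_simp

end SiteField

end PolyaSum

/-! ### Asymptotics of `(1 - l / L_k) ^ n_k` -/

namespace PolyaSum

section Asymptotics

variable {n : ℕ → ℕ} {L : ℕ → ℝ} {l : ℝ}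

theorem eventually_div_mem (hL : Tendsto L atTop atTop) (hl : 0 ≤ l) :
    ∀ᶠ k in atTop, 0 < L k ∧ 0 ≤ l / L k ∧ l / L k ≤ 1 / 2 := by
  filter_upwards [hL.eventually_gt_atTop 0, hL.eventually_ge_atTop (2 * l)] with k h0 h1
  refine ⟨h0, by positivity, ?_⟩
  rw [div_le_div_iff₀ h0 two_pos]
  linarith

theorem le_neg_log_one_sub {x : ℝ} (hx : x ≤ 1 / 2) : x ≤ -Real.log (1 - x) := by
  have := Real.log_le_sub_one_of_pos (show 0 < 1 - x by linarith)
  linarith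

theorem neg_log_one_sub_le {x : ℝ} (hx : x ≤ 1 / 2) : -Real.log (1 - x) ≤ x / (1 - x) := by
  have h := Real.one_sub_inv_le_log_of_pos (show 0 < 1 - x by linarith)
  have : x / (1 - x) = (1 - x)⁻¹ - 1 := by
    have : 1 - x ≠ 0 := by linarith
    field_simp
    ring
  linarith

theorem one_sub_pow_eq_exp {x : ℝ} (hx : x ≤ 1 / 2) (j : ℕ) :
    (1 - x) ^ j = Real.exp (-(j * -Real.log (1 - x))) := by
  rw [show -((j : ℝ) * -Real.log (1 - x)) = j * Real.log (1 - x) by ring, Real.exp_nat_mul,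
    Real.exp_log (by linarith)]

theorem tendsto_div_zero (hL : Tendsto L atTop atTop) :
    Tendsto (fun k => l / L k) atTop (𝓝 0) :=
  hL.const_div_atTop l

/-- After taking logarithms, `x ≤ -log (1 - x) ≤ x / (1 - x)` with `x = l / L k → 0` squeezes the
exponent. -/
theorem tendsto_one_sub_div_pow (hL : Tendsto L atTop atTop) (hl : 0 ≤ l) {w : ℝ}
    (h : Tendsto (fun k => n k / L k) atTop (𝓝 w)) :
    Tendsto (fun k => (1 - l / L k) ^ n k) atTop (𝓝 (Real.exp (-(w * l)))) := by
  have h1 : Tendsto (fun k => (n k : ℝ) * (l / L k)) atTop (𝓝 (w * l)) := by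
    refine (h.mul_const l).congr fun k => by ring
  have h2 : Tendsto (fun k => (n k : ℝ) * (l / L k) / (1 - l / L k)) atTop (𝓝 (w * l)) := by
    have := h1.div ((tendsto_div_zero (l := l) hL).const_sub 1) (by simp)
    simpa [Pi.div_def] using this
  have h3 : Tendsto (fun k => (n k : ℝ) * -Real.log (1 - l / L k)) atTop (𝓝 (w * l)) := by
    refine tendsto_of_tendsto_of_tendsto_of_le_of_le' h1 h2 ?_ ?_
    · filter_upwards [eventually_div_mem hL hl] with k hk
      gcongr
      exact le_neg_log_one_sub hk.2.2
    · filter_upwards [eventually_div_mem hL hl] with k hk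
      rw [mul_div_assoc]
      gcongr
      exact neg_log_one_sub_le hk.2.2
  refine ((Real.continuous_exp.tendsto _).comp h3.neg).congr' ?_
  filter_upwards [eventually_div_mem hL hl] with k hk
  exact (one_sub_pow_eq_exp hk.2.2 _).symm

theorem tendsto_one_sub_div_pow_zero (hL : Tendsto L atTop atTop) (hl : 0 < l)
    (h : Tendsto (fun k => n k / L k) atTop atTop) :
    Tendsto (fun k => (1 - l / L k) ^ n k) atTop (𝓝 0) := by
  have h1 : Tendsto (fun k => (n k : ℝ) * (l / L k)) atTop atTop :=
    (h.atTop_mul_const hl).congr fun k => by ring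
  refine squeeze_zero' ?_ ?_ (Real.tendsto_exp_neg_atTop_nhds_zero.comp h1)
  · filter_upwards [eventually_div_mem hL hl.le] with k hk
    have : 0 ≤ 1 - l / L k := by linarith
    positivity
  · filter_upwards [eventually_div_mem hL hl.le] with k hk
    rw [one_sub_pow_eq_exp hk.2.2]
    simp only [Function.comp, Real.exp_le_exp, neg_le_neg_iff]
    gcongr
    exact le_neg_log_one_sub hk.2.2

/-- The exponents `u k` determine `n k / L k` up to a factor tending to one. A positive limit of the
powers makes `u` converge, and the limit zero sends it to infinity. -/
theorem tendsto_div_of_tendsto_one_sub_div_pow (hL : Tendsto L atTop atTop) (hl : 0 < l) {y : ℝ}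
    (h : Tendsto (fun k => (1 - l / L k) ^ n k) atTop (𝓝 y)) :
    (∃ w, Tendsto (fun k => n k / L k) atTop (𝓝 w)) ∨
      Tendsto (fun k => n k / L k) atTop atTop := by
  set u : ℕ → ℝ := fun k => (n k : ℝ) * -Real.log (1 - l / L k) with hu
  have hev := eventually_div_mem hL hl.le
  have hexp : Tendsto (fun k => Real.exp (-u k)) atTop (𝓝 y) := by
    refine h.congr' ?_
    filter_upwards [hev] with k hk
    exact one_sub_pow_eq_exp hk.2.2 _
  have hy : 0 ≤ y := ge_of_tendsto' hexp fun k => (Real.exp_pos _).le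
  have hlow : ∀ᶠ k in atTop, (1 - l / L k) * u k / l ≤ n k / L k := by
    filter_upwards [hev] with k hk
    have h1 : 0 < 1 - l / L k := by linarith
    have h2 : (1 - l / L k) * -Real.log (1 - l / L k) ≤ l / L k := by
      have := mul_le_mul_of_nonneg_left (neg_log_one_sub_le hk.2.2) h1.le
      rwa [mul_div_cancel₀ _ h1.ne'] at this
    rw [div_le_iff₀ hl]
    calc (1 - l / L k) * u k = n k * ((1 - l / L k) * -Real.log (1 - l / L k)) := by
          simp only [hu]; ring
      _ ≤ n k * (l / L k) := by gcongr
      _ = n k / L k * l := by ring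
  rcases hy.eq_or_lt with rfl | hy
  · right
    have hut : Tendsto u atTop atTop := by
      have := Real.tendsto_exp_comp_nhds_zero.1 hexp
      simpa using tendsto_neg_atBot_iff.1 this
    -- The constant comes from `1 - l / L k ≥ 1 / 2`, valid eventually.
    refine tendsto_atTop_mono' _ ?_ (hut.atTop_mul_const (show 0 < (2 * l)⁻¹ by positivity))
    filter_upwards [hlow, hev, hut.eventually_ge_atTop 0] with k h1 h2 h3
    refine le_trans ?_ h1
    rw [le_div_iff₀ hl]
    have : u k * (2 * l)⁻¹ * l = 1 / 2 * u k := by field_simp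
    rw [this]
    gcongr
    linarith
  · left
    have hut : Tendsto u atTop (𝓝 (-Real.log y)) := by
      have := (Real.continuousAt_log hy.ne').tendsto.comp hexp
      simpa [Function.comp_def] using this.neg
    refine ⟨-Real.log y / l, ?_⟩
    refine tendsto_of_tendsto_of_tendsto_of_le_of_le' (g := fun k => (1 - l / L k) * u k / l)
      (h := fun k => u k / l) ?_ (hut.div_const l) hlow ?_
    · have := (((tendsto_div_zero (l := l) hL).const_sub 1).mul hut).div_const l
      simpa using this
    · filter_upwards [hev] with k hk
      rw [le_div_iff₀ hl]
      calc (n k : ℝ) / L k * l = n k * (l / L k) := by ring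
        _ ≤ u k := by
          simp only [hu]
          gcongr
          exact le_neg_log_one_sub hk.2.2

end Asymptotics

end PolyaSum

/-! ### Conditional expectations from a kernel; measurability of the limit `W` -/

namespace PolyaSum

open PointMeasure

section Disintegration

/-- The hypothesis on `S` is the defining set-integral identity of conditional expectation, stated
for measures; integrating `φ` transfers it to all of `L¹` at once. -/
theorem condExp_ae_eq_integral_of_comp_restrict {Ω : Type*} {m m0 : MeasurableSpace Ω}
    (hm : m ≤ m0) {P : Measure Ω} [IsProbabilityMeasure P] {κ : Kernel ℝ Ω} [IsMarkovKernel κ]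
    {W : Ω → ℝ} (hW : Measurable[m] W)
    (h : ∀ S, MeasurableSet[m] S →
      (κ.comap W (hW.mono hm le_rfl)) ∘ₘ (P.restrict S) = P.restrict S)
    {φ : Ω → ℝ} (hφ : Integrable φ P) :
    (∀ᵐ ω ∂P, Integrable φ (κ (W ω))) ∧ P[φ | m] =ᵐ[P] fun ω => ∫ x, φ x ∂κ (W ω) := by
  set K := κ.comap W (hW.mono hm le_rfl)
  have hK : K ∘ₘ P = P := by simpa using h Set.univ MeasurableSet.univ
  have hφK : ∀ S, MeasurableSet[m] S → Integrable φ ((K ∘ₖ Kernel.const Unit (P.restrict S)) ()) :=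
    fun S hS => by
      rw [← Measure.comp_eq_comp_const_apply, h S hS]
      exact hφ.restrict
  have hint : ∀ S, MeasurableSet[m] S →
      IntegrableOn (fun ω => ∫ x, φ x ∂κ (W ω)) S P := fun S hS => (hφK S hS).integral_comp
  refine ⟨?_, ?_⟩
  · have := (hφK Set.univ MeasurableSet.univ).ae_of_comp
    rw [Kernel.const_apply, Measure.restrict_univ] at this
    exact this
  · symm
    refine ae_eq_condExp_of_forall_setIntegral_eq hm hφ (fun S hS _ => hint S hS)
      (fun S hS _ => ?_) ?_
    · have := Kernel.integral_comp (hφK S hS)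
      rw [← Measure.comp_eq_comp_const_apply, h S hS] at this
      exact this.symm
    -- Measurability of the kernel integral needs a strongly measurable version of `φ`. It may be
    -- used because `K` leaves `P` invariant, so `P`-null changes of `φ` are null for almost every
    -- `κ (W ω)`.
    · have hmk := hφ.1.stronglyMeasurable_mk
      refine ⟨fun ω => ∫ x, hφ.1.mk φ x ∂κ (W ω), ?_, ?_⟩
      · exact (hmk.integral_kernel (κ := κ)).comp_measurable hW
      · have hae : ∀ᵐ x ∂(K ∘ₖ Kernel.const Unit P) (), φ x = hφ.1.mk φ x := by
          rw [← Measure.comp_eq_comp_const_apply, hK]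
          exact hφ.1.ae_eq_mk
        filter_upwards [Kernel.ae_ae_of_ae_comp hae] with ω hω
        exact integral_congr_ae hω

end Disintegration

section Tail

variable {X : Type*} [MetricSpace X] [MeasurableSpace X] {z : ℝ} {ρ : Measure X}

theorem neg_log_pos (hz0 : 0 < z) (hz1 : z < 1) : 0 < -Real.log (1 - z) := by
  have := Real.log_neg (show 0 < 1 - z by linarith) (by linarith)
  linarith

omit [MetricSpace X] in
theorem toReal_levy_const (hz0 : 0 < z) (hz1 : z < 1) (A : Set X) :
    (levy z ρ fun _ => A).toReal = -Real.log (1 - z) * ρ.real A := by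
  rw [levy_const hz0 hz1, ENNReal.toReal_mul, ENNReal.toReal_ofReal (neg_log_pos hz0 hz1).le,
    measureReal_def]

theorem tendsto_measureReal_atTop (hρ : LocallyFinite ρ) (hinf : ρ Set.univ = ∞)
    {B : ℕ → BddBorel X} (hmono : Monotone fun n => (B n : Set X))
    (hunion : ⋃ n, (B n : Set X) = Set.univ) :
    Tendsto (fun k => ρ.real (B k)) atTop atTop := by
  have h := tendsto_measure_iUnion_atTop (μ := ρ) hmono
  rw [hunion, hinf] at h
  refine tendsto_atTop.2 fun b => ?_
  filter_upwards [(tendsto_order.1 h).1 (ENNReal.ofReal b) ENNReal.ofReal_lt_top] with k hk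
  exact (ENNReal.ofReal_le_iff_le_toReal (hρ (B k)).ne).1 hk.le

variable {B : ℕ → BddBorel X}

theorem tendsto_rate_atTop (hz0 : 0 < z) (hz1 : z < 1) (hρ : LocallyFinite ρ)
    (hinf : ρ Set.univ = ∞) (hmono : Monotone fun n => (B n : Set X))
    (hunion : ⋃ n, (B n : Set X) = Set.univ) :
    Tendsto (fun k => -Real.log (1 - z) * ρ.real (B k)) atTop atTop :=
  (tendsto_measureReal_atTop hρ hinf hmono hunion).const_mul_atTop (neg_log_pos hz0 hz1)

theorem measurableSet_tailField_iff {S : Set (PointMeasure X)} :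
    MeasurableSet[tailField B] S ↔ ∀ m, MeasurableSet[siteField (B m)] S :=
  MeasurableSpace.measurableSet_iInf

theorem tendsto_siteLimit {μ : PointMeasure X} (hμ : μ ∈ convergenceSet z ρ B) :
    Tendsto (fun k => siteRatio z ρ B k μ) atTop (𝓝 (siteLimit z ρ B μ)) := by
  have h : ∃ w : ℝ, Tendsto (fun k => siteRatio z ρ B k μ) atTop (𝓝 w) := hμ
  rw [siteLimit, dif_pos h]
  exact h.choose_spec

theorem siteLimit_of_notMem {μ : PointMeasure X} (hμ : μ ∉ convergenceSet z ρ B) :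
    siteLimit z ρ B μ = 0 :=
  dif_neg hμ

theorem siteLimit_nonneg (hz0 : 0 < z) (hz1 : z < 1) (μ : PointMeasure X) :
    0 ≤ siteLimit z ρ B μ := by
  by_cases hμ : μ ∈ convergenceSet z ρ B
  · refine ge_of_tendsto' (tendsto_siteLimit hμ) fun k => ?_
    have := neg_log_pos hz0 hz1
    rw [siteRatio]
    positivity
  · rw [siteLimit_of_notMem hμ]

variable [BorelSpace X] [SecondCountableTopology X]

theorem tailField_le : tailField B ≤ instMeasurableSpace :=
  (iInf_le _ 0).trans (siteField_le (B 0))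

theorem measurable_siteRatio (hmono : Monotone fun n => (B n : Set X)) {k m : ℕ} (hmk : m ≤ k) :
    Measurable[siteField (B m)] (siteRatio z ρ B k) := by
  have h : Measurable[siteField (B m)] (sites (B k)) :=
    (measurable_sites_siteField (B k)).mono (siteField_anti (hmono hmk)) le_rfl
  exact (measurable_from_top (f := fun j : ℕ =>
    (j : ℝ) / (-Real.log (1 - z) * ρ.real (B k)))).comp h

theorem measurableSet_tailField_tendsto_atTop (hmono : Monotone fun n => (B n : Set X)) :
    MeasurableSet[tailField B]
      {μ | Tendsto (fun k => siteRatio z ρ B k μ) atTop atTop} := by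
  refine measurableSet_tailField_iff.2 fun m => ?_
  -- Dropping the first `m` ratios leaves the limit behaviour unchanged, and all later ones are
  -- measurable for `siteField (B m)`.
  simp_rw [← tendsto_add_atTop_iff_nat (f := fun k => siteRatio z ρ B k _) m]
  exact measurableSet_tendsto atTop fun k =>
    measurable_siteRatio hmono (Nat.le_add_left m k)

theorem measurableSet_convergenceSet (hmono : Monotone fun n => (B n : Set X)) (m : ℕ) :
    MeasurableSet[siteField (B m)] (convergenceSet z ρ B) := by
  have : convergenceSet z ρ B =
      {μ | ∃ w, Tendsto (fun k => siteRatio z ρ B (k + m) μ) atTop (𝓝 w)} := by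
    ext μ
    exact exists_congr fun w => (tendsto_add_atTop_iff_nat m).symm
  rw [this]
  exact @StronglyMeasurable.measurableSet_exists_tendsto _ _ _ (siteField (B m)) _ _ _ _ _ _ fun k =>
    Measurable.stronglyMeasurable (measurable_siteRatio hmono (Nat.le_add_left m k))

theorem measurable_siteLimit (hmono : Monotone fun n => (B n : Set X)) :
    Measurable[tailField B] (siteLimit z ρ B) := by
  rw [measurable_iff_comap_le]
  refine le_iInf fun m => measurable_iff_comap_le.1 ?_
  have hconv := measurableSet_convergenceSet (z := z) (ρ := ρ) hmono m
  refine @measurable_of_tendsto_metrizable _ _ (siteField (B m)) _ _ _ _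
    (fun k => (convergenceSet z ρ B).indicator (siteRatio z ρ B (k + m))) _
    (fun k => (measurable_siteRatio hmono (Nat.le_add_left m k)).indicator hconv) ?_
  refine tendsto_pi_nhds.2 fun μ => ?_
  by_cases hμ : μ ∈ convergenceSet z ρ B
  · simp_rw [Set.indicator_of_mem hμ]
    exact (tendsto_add_atTop_iff_nat m).2 (tendsto_siteLimit hμ)
  · simp_rw [Set.indicator_of_notMem hμ]
    rw [siteLimit_of_notMem hμ]
    exact tendsto_const_nhds

end Tail

end PolyaSum

/-! ### The ensemble `C(π)` and its tail disintegration -/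

namespace PolyaSum

open PointMeasure

section Ensemble

variable {X : Type*} [MetricSpace X] [MeasurableSpace X] {z : ℝ} {ρ : Measure X}

omit [MetricSpace X] in
theorem smul_singleton_eq_zero (hdiff : ∀ x, ρ {x} = 0) (w : ℝ≥0∞) (x : X) :
    (w • ρ) {x} = 0 := by
  simp [hdiff]

theorem LocallyFinite.smul (hρ : LocallyFinite ρ) {w : ℝ≥0∞} (hw : w ≠ ∞) :
    LocallyFinite (w • ρ) := fun B => by
  rw [Measure.smul_apply, smul_eq_mul]
  exact ENNReal.mul_lt_top hw.lt_top (hρ B)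

variable [BorelSpace X] [SecondCountableTopology X]

theorem polya_smul_void (hz0 : 0 < z) (hz1 : z < 1) (hρ : LocallyFinite ρ)
    (hdiff : ∀ x, ρ {x} = 0) (w : ℝ) (A : BddBorel X) {C : ℕ → Set X}
    (hC : ∀ m, MeasurableSet (C m)) (hCA : ∀ m, C m ⊆ A) :
    polya z (ENNReal.ofReal w • ρ) (void C) =
      ENNReal.ofReal (Real.exp (-(max w 0 * (levy z ρ C).toReal))) := by
  rw [(isPolyaSumProcess_polya hz0 hz1 (hρ.smul ENNReal.ofReal_ne_top)
    (smul_singleton_eq_zero hdiff _)).measure_void hz0 hz1 (hρ.smul ENNReal.ofReal_ne_top)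
    (smul_singleton_eq_zero hdiff _) A hC hCA, levy_smul, ENNReal.toReal_mul,
    ENNReal.toReal_ofReal']

theorem measurable_polya_smul (hz0 : 0 < z) (hz1 : z < 1) (hρ : LocallyFinite ρ)
    (hdiff : ∀ x, ρ {x} = 0) :
    Measurable fun w : ℝ => polya z (ENNReal.ofReal w • ρ) := by
  have hp := fun w => (isPolyaSumProcess_polya hz0 hz1
    (hρ.smul (ENNReal.ofReal_ne_top (r := w))) (smul_singleton_eq_zero hdiff _)).1
  refine Measurable.measure_of_isPiSystem_of_isProbabilityMeasure generateFrom_voidSystem.symm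
    isPiSystem_voidSystem ?_
  rintro _ ⟨A, C, hC, hCA, rfl⟩
  simp_rw [polya_smul_void hz0 hz1 hρ hdiff _ A hC hCA]
  fun_prop

variable {P : Measure (PointMeasure X)} {B : ℕ → BddBorel X}

theorem condExp_void (hz0 : 0 < z) (hz1 : z < 1) (hρ : LocallyFinite ρ)
    (hdiff : ∀ x, ρ {x} = 0) (hP : P ∈ siteEnsemble z ρ) {A : BddBorel X} {C : ℕ → Set X}
    (hC : ∀ m, MeasurableSet (C m)) (hCA : ∀ m, C m ⊆ A)
    (hA : 0 < -Real.log (1 - z) * ρ.real A) :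
    P[(void C).indicator (fun _ => (1 : ℝ)) | siteField A] =ᵐ[P] fun μ =>
      (1 - (levy z ρ C).toReal / (-Real.log (1 - z) * ρ.real A)) ^ sites A μ := by
  refine (hP.2 A _ (measurableSet_void hC)).trans (ae_of_all _ fun μ => ?_)
  rw [← toReal_levy_const hz0 hz1] at hA ⊢
  exact siteKernel_void hz0 hz1 hρ hdiff hC hCA hA μ

/-- A tail event lies in every `𝒢_{B_k}`, so integrating the conditional probability of the void
event over `S` gives the same value for all large `k`; bounded convergence passes to the limit. -/
theorem measureReal_void_inter (hz0 : 0 < z) (hz1 : z < 1) (hρ : LocallyFinite ρ)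
    (hdiff : ∀ x, ρ {x} = 0) (hinf : ρ Set.univ = ∞) (hmono : Monotone fun n => (B n : Set X))
    (hunion : ⋃ n, (B n : Set X) = Set.univ) (hP : P ∈ siteEnsemble z ρ) {j : ℕ} {C : ℕ → Set X}
    (hC : ∀ m, MeasurableSet (C m)) (hCB : ∀ m, C m ⊆ B j) {S : Set (PointMeasure X)}
    (hS : MeasurableSet[tailField B] S) {f : PointMeasure X → ℝ}
    (hf : ∀ᵐ μ ∂P, μ ∈ S → Tendsto (fun k => (1 - (levy z ρ C).toReal /
      (-Real.log (1 - z) * ρ.real (B k))) ^ sites (B k) μ) atTop (𝓝 (f μ))) :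
    P.real (void C ∩ S) = ∫ μ in S, f μ ∂P := by
  have := hP.1
  have hL := tendsto_rate_atTop hz0 hz1 hρ hinf hmono hunion
  have hev := eventually_div_mem hL (ENNReal.toReal_nonneg (a := levy z ρ C))
  have hSm : MeasurableSet S := tailField_le _ hS
  have hmeas : ∀ k, Measurable fun μ : PointMeasure X => (1 - (levy z ρ C).toReal /
      (-Real.log (1 - z) * ρ.real (B k))) ^ sites (B k) μ := fun k =>
    (measurable_from_top (f := fun i : ℕ => (1 - (levy z ρ C).toReal /
      (-Real.log (1 - z) * ρ.real (B k))) ^ i)).comp (measurable_sites (B k))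
  have hlim := tendsto_integral_filter_of_dominated_convergence (μ := P.restrict S) (fun _ => 1)
    (Eventually.of_forall fun k => (hmeas k).aestronglyMeasurable)
    (hev.mono fun k hk => ae_of_all _ fun μ => by
      rw [Real.norm_of_nonneg (pow_nonneg (by linarith) _)]
      exact pow_le_one₀ (by linarith) (by linarith))
    (integrable_const _) ((ae_restrict_iff' hSm).2 hf)
  refine tendsto_nhds_unique (Tendsto.congr' ?_ tendsto_const_nhds) hlim
  filter_upwards [hev, eventually_ge_atTop j] with k hk hjk
  have hint : Integrable ((void C).indicator fun _ => (1 : ℝ)) P :=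
    (integrable_const _).indicator (measurableSet_void hC)
  have h1 := setIntegral_condExp (siteField_le (B k)) hint (measurableSet_tailField_iff.1 hS k)
  rw [setIntegral_indicator (measurableSet_void hC), setIntegral_const, smul_eq_mul, mul_one,
    Set.inter_comm] at h1
  rw [← h1]
  exact setIntegral_congr_ae hSm ((condExp_void hz0 hz1 hρ hdiff hP hC
    (fun m => (hCB m).trans (hmono hjk)) hk.1).mono fun μ hμ _ => hμ)

theorem weight_pos (hz0 : 0 < z) (m : ℕ) : 0 < weight z m := by
  rw [weight_eq_ofReal hz0.le, ENNReal.ofReal_pos]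
  positivity

/-- One void event in a fixed `B j` suffices to show that the ratios converge or diverge to
infinity; the family over all `r` then excludes divergence. -/
theorem ae_mem_convergenceSet (hz0 : 0 < z) (hz1 : z < 1) (hρ : LocallyFinite ρ)
    (hdiff : ∀ x, ρ {x} = 0) (hinf : ρ Set.univ = ∞) (hmono : Monotone fun n => (B n : Set X))
    (hunion : ⋃ n, (B n : Set X) = Set.univ) (hP : P ∈ siteEnsemble z ρ) :
    ∀ᵐ μ ∂P, μ ∈ convergenceSet z ρ B := by
  classical
  have := hP.1
  have hL := tendsto_rate_atTop hz0 hz1 hρ hinf hmono hunion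
  obtain ⟨j, hj⟩ := (hL.eventually_gt_atTop 0).exists
  -- the configurations without sites of multiplicity greater than `r` in `B j`
  let C : ℕ → ℕ → Set X := fun r m => if r ≤ m then B j else ∅
  have hC : ∀ r m, MeasurableSet (C r m) := fun r m => by
    simp only [C]
    split_ifs
    exacts [(B j).2.1, MeasurableSet.empty]
  have hCB : ∀ r m, C r m ⊆ B j := fun r m => by
    simp only [C]
    split_ifs
    exacts [subset_rfl, Set.empty_subset _]
  have hl : ∀ r, 0 < (levy z ρ (C r)).toReal := fun r => by
    refine ENNReal.toReal_pos (ne_of_gt ?_) (levy_lt_top hz0 hz1 hρ (B j) (hCB r)).ne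
    have hj0 : 0 < ρ (B j) := by
      have := pos_of_mul_pos_right hj (neg_log_pos hz0 hz1).le
      exact (ENNReal.toReal_pos_iff.1 this).1
    have : weight z r * ρ (C r r) ≤ levy z ρ (C r) :=
      ENNReal.le_tsum (f := fun m => weight z m * ρ (C r m)) r
    refine lt_of_lt_of_le ?_ this
    simp only [C, le_refl, if_true]
    exact ENNReal.mul_pos (weight_pos hz0 r).ne' hj0.ne'
  have hdich : ∀ᵐ μ ∂P, μ ∈ convergenceSet z ρ B ∨
      Tendsto (fun k => siteRatio z ρ B k μ) atTop atTop := by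
    have hG : Antitone fun k => siteField (B k) := fun a b hab => siteField_anti (hmono hab)
    have hrev := ae_exists_tendsto_condExp_antitone (P := P) hG (fun k => siteField_le (B k))
      (φ := (void (C 0)).indicator fun _ => (1 : ℝ))
      ((integrable_const _).indicator (measurableSet_void (hC 0)))
      (ae_of_all _ fun μ => by by_cases hμ : μ ∈ void (C 0) <;> simp [hμ])
    have hform : ∀ᵐ μ ∂P, ∀ k, j ≤ k → P[(void (C 0)).indicator fun _ => (1 : ℝ) |
        siteField (B k)] μ = (1 - (levy z ρ (C 0)).toReal /
          (-Real.log (1 - z) * ρ.real (B k))) ^ sites (B k) μ := by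
      refine ae_all_iff.2 fun k => ?_
      by_cases hk : j ≤ k
      · have hk0 : 0 < -Real.log (1 - z) * ρ.real (B k) := hj.trans_le
          (mul_le_mul_of_nonneg_left (ENNReal.toReal_mono (hρ (B k)).ne (measure_mono (hmono hk)))
            (neg_log_pos hz0 hz1).le)
        filter_upwards [condExp_void hz0 hz1 hρ hdiff hP (hC 0)
          (fun m => (hCB 0 m).trans (hmono hk)) hk0] with μ hμ _ using hμ
      · exact ae_of_all _ fun μ h => absurd h hk
    filter_upwards [hrev, hform] with μ ⟨y, hy⟩ hμ
    refine tendsto_div_of_tendsto_one_sub_div_pow hL (hl 0) (y := y) (hy.congr' ?_)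
    filter_upwards [eventually_ge_atTop j] with k hk using hμ k hk
  set E : Set (PointMeasure X) := {μ | Tendsto (fun k => siteRatio z ρ B k μ) atTop atTop}
  have hE : MeasurableSet[tailField B] E := measurableSet_tailField_tendsto_atTop hmono
  -- On `E` the conditional void probabilities tend to zero, because every `C r` has positive Lévy
  -- mass.
  have hEr : ∀ r, P (void (C r) ∩ E) = 0 := fun r => by
    have := measureReal_void_inter hz0 hz1 hρ hdiff hinf hmono hunion hP (hC r) (hCB r) hE
      (f := fun _ => 0) (ae_of_all _ fun μ hμ => tendsto_one_sub_div_pow_zero hL (hl r) hμ)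
    rw [integral_zero] at this
    exact (measureReal_eq_zero_iff (measure_ne_top _ _)).1 this
  have hE0 : P E = 0 := by
    refine measure_mono_null (fun μ hμ => ?_) (measure_iUnion_null hEr)
    obtain ⟨n, hn⟩ := μ.2 (B j)
    -- A site in `B j` has multiplicity at most `n = μ (B j)`, so `r = n` works.
    refine Set.mem_iUnion.2 ⟨n, fun m x hx hm => ?_, hμ⟩
    simp only [C] at hx
    split_ifs at hx with hnm
    · have h1 : μ.1 {x} ≤ μ.1 (B j) := measure_mono (Set.singleton_subset_iff.2 hx)
      rw [hm, hn] at h1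
      have : m + 1 ≤ n := by exact_mod_cast h1
      omega
    · exact hx
  filter_upwards [hdich, compl_mem_ae_iff.2 hE0] with μ h1 h2
  exact h1.resolve_right h2

/-- Both sides agree on void events, since `exp (-W λ(C))` is at once the limit of the conditional
probabilities and the void probability of `Poy_{z,Wρ}`. Cofinality places any bounded set inside
some `B j`. -/
theorem comp_restrict_tail (hz0 : 0 < z) (hz1 : z < 1) (hρ : LocallyFinite ρ)
    (hdiff : ∀ x, ρ {x} = 0) (hinf : ρ Set.univ = ∞) (hmono : Monotone fun n => (B n : Set X))
    (hunion : ⋃ n, (B n : Set X) = Set.univ)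
    (hcofinal : ∀ A : BddBorel X, ∃ n, (A : Set X) ⊆ B n) (hP : P ∈ siteEnsemble z ρ)
    {κ : Kernel (PointMeasure X) (PointMeasure X)} [IsMarkovKernel κ]
    (hκ : ∀ μ, κ μ = polya z (ENNReal.ofReal (siteLimit z ρ B μ) • ρ))
    {S : Set (PointMeasure X)} (hS : MeasurableSet[tailField B] S) :
    κ ∘ₘ (P.restrict S) = P.restrict S := by
  have := hP.1
  have hL := tendsto_rate_atTop hz0 hz1 hρ hinf hmono hunion
  have hSm : MeasurableSet S := tailField_le _ hS
  refine ext_of_void ?_ fun A C hC hCA => ?_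
  · simp [Measure.bind_apply MeasurableSet.univ κ.aemeasurable]
  obtain ⟨j, hj⟩ := hcofinal A
  have hWm : Measurable (siteLimit z ρ B) := (measurable_siteLimit hmono).mono tailField_le le_rfl
  have hreal := measureReal_void_inter hz0 hz1 hρ hdiff hinf hmono hunion hP hC
    (fun m => (hCA m).trans hj) hS
    (f := fun μ => Real.exp (-(siteLimit z ρ B μ * (levy z ρ C).toReal))) (by
      filter_upwards [ae_mem_convergenceSet hz0 hz1 hρ hdiff hinf hmono hunion hP] with μ hμ _
      exact tendsto_one_sub_div_pow hL ENNReal.toReal_nonneg (tendsto_siteLimit hμ))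
  rw [Measure.bind_apply (measurableSet_void hC) κ.aemeasurable,
    Measure.restrict_apply (measurableSet_void hC), ← ENNReal.ofReal_toReal
      (measure_ne_top P (void C ∩ S)), ← measureReal_def, hreal,
    ofReal_integral_eq_lintegral_ofReal]
  · refine lintegral_congr fun μ => ?_
    rw [hκ, polya_smul_void hz0 hz1 hρ hdiff _ A hC hCA,
      max_eq_left (siteLimit_nonneg hz0 hz1 μ)]
  · refine Integrable.of_bound (C := 1) ?_ (ae_of_all _ fun μ => ?_)
    · exact (Real.measurable_exp.comp (hWm.mul_const _).neg).aestronglyMeasurable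
    · rw [Real.norm_of_nonneg (Real.exp_pos _).le, Real.exp_le_one_iff, neg_nonpos]
      exact mul_nonneg (siteLimit_nonneg hz0 hz1 μ) ENNReal.toReal_nonneg
  · exact ae_of_all _ fun μ => (Real.exp_pos _).le

end Ensemble

end PolyaSum

theorem mainTheorem5 {X : Type*} [MetricSpace X] [CompleteSpace X] [SecondCountableTopology X]
    [MeasurableSpace X] [BorelSpace X]
    (z : ℝ) (hz0 : 0 < z) (hz1 : z < 1)
    (ρ : Measure X) (hρ : PolyaSum.LocallyFinite ρ)
    (hdiffuse : ∀ x, ρ {x} = 0) (hinfinite : ρ Set.univ = ∞)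
    (B : ℕ → PolyaSum.BddBorel X) (hmono : Monotone fun n => (B n : Set X))
    (hunion : ⋃ n, (B n : Set X) = Set.univ)
    (hcofinal : ∀ A : PolyaSum.BddBorel X, ∃ n, (A : Set X) ⊆ B n) :
    -- the processes `Poy_{z, wρ}`, `0 ≤ w < ∞`, are well defined
    (∀ w : ℝ≥0, ∃! Q, PolyaSum.IsPolyaSumProcess z ((w : ℝ≥0∞) • ρ) Q) ∧
    ∀ P ∈ PolyaSum.siteEnsemble z ρ,
      (∀ᵐ μ ∂P, μ ∈ PolyaSum.convergenceSet z ρ B) ∧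
      (∀ φ : PolyaSum.PointMeasure X → ℝ, Integrable φ P →
        (∀ᵐ μ ∂P, Integrable φ
          (PolyaSum.polya z (ENNReal.ofReal (PolyaSum.siteLimit z ρ B μ) • ρ))) ∧
        P[φ | PolyaSum.tailField B] =ᵐ[P] fun μ =>
          ∫ ν, φ ν ∂PolyaSum.polya z (ENNReal.ofReal (PolyaSum.siteLimit z ρ B μ) • ρ)) ∧
      (∀ᵐ μ ∂P, Tendsto (fun k => (PolyaSum.PointMeasure.sites (B k) μ : ℝ) / ρ.real (B k)) atTop
        (𝓝 (-(PolyaSum.siteLimit z ρ B μ) * Real.log (1 - z)))) := by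
  refine ⟨fun w => PolyaSum.existsUnique_isPolyaSumProcess hz0 hz1 (hρ.smul ENNReal.coe_ne_top)
    (PolyaSum.smul_singleton_eq_zero hdiffuse _), fun P hP => ?_⟩
  have hconv := PolyaSum.ae_mem_convergenceSet hz0 hz1 hρ hdiffuse hinfinite hmono hunion hP
  refine ⟨hconv, fun φ hφ => ?_, ?_⟩
  · have := hP.1
    -- Negative parameters are sent to intensity zero by `ENNReal.ofReal`; this is harmless as `W ≥
    -- 0`.
    let κ : Kernel ℝ (PolyaSum.PointMeasure X) :=
      ⟨fun w => PolyaSum.polya z (ENNReal.ofReal w • ρ),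
        PolyaSum.measurable_polya_smul hz0 hz1 hρ hdiffuse⟩
    have : IsMarkovKernel κ := ⟨fun w => (PolyaSum.isPolyaSumProcess_polya hz0 hz1
      (hρ.smul ENNReal.ofReal_ne_top) (PolyaSum.smul_singleton_eq_zero hdiffuse _)).1⟩
    exact PolyaSum.condExp_ae_eq_integral_of_comp_restrict PolyaSum.tailField_le (κ := κ)
      (PolyaSum.measurable_siteLimit hmono) (fun S hS => PolyaSum.comp_restrict_tail hz0 hz1 hρ
        hdiffuse hinfinite hmono hunion hcofinal hP (fun μ => rfl) hS) hφ
  · filter_upwards [hconv] with μ hμ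
    have hlog := (PolyaSum.neg_log_pos hz0 hz1).ne'
    have h := (PolyaSum.tendsto_siteLimit hμ).mul_const (-Real.log (1 - z))
    rw [mul_neg, ← neg_mul] at h
    refine h.congr fun k => ?_
    rw [PolyaSum.siteRatio, div_mul_eq_mul_div, mul_comm, mul_div_mul_left _ _ hlog]
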